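/- **Theorem.** Let $P=(P_1,\dots,P_n)$ be a labelled planar point set in general position, i.e. the points are pairwise distinct and no three are collinear. An ordering (permutation) $\sigma$ of the labels $1,\dots,n$ is *monotone* for $P$ if there is a line $\ell$, traversed in one of its two directions, such that the orthogonal projections of $P_{\sigma(1)},\dots,P_{\sigma(n)}$ to $\ell$ are distinct and are met in this order. Two labelled point sets $P$ and $Q$ of $n$ points each *have compatible monotone paths* if some ordering of the labels is monotone for both $P$ and $Q$. There is an algorithm which, given $n$ and the coordinates of any two labelled point sets $P$ and $Q$ in general position, each of $n$ points labelled $1,\dots,n$, outputs an ordering of the labels that is monotone for both $P$ and $Q$ if there is one, and otherwise reports that none exists. For $n\ge 2$ it takes at most $C\,n^2\log n$ steps, with a constant $C$ independent of $n$, $P$ and $Q$. The algorithm is a single program, independent of $n$, for a real RAM: memory cells hold either real numbers or integers; reading a cell (with computed address), writing a cell, addition, subtraction and multiplication of reals or of integers, and comparison of two reals or two integers cost one step each. There is no division, no rounding and no conversion between reals and integers. All integers stored and all addresses written to are less than $(n+2)^{d}$ for some constant $d$ (words of $O(\log n)$ bits). -/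

import Mathlib

/-! ## Labelled point sets and monotone orderings -/

/-- The Euclidean plane. -/
abbrev Plane : Type := EuclideanSpace ℝ (Fin 2)

/-- A labelled planar point set in general position: the points are pairwise distinct
and no three of them lie on a line. -/
def InGeneralPosition {n : ℕ} (P : Fin n → Plane) : Prop :=
  Function.Injective P ∧
    ∀ i j k : Fin n, i ≠ j → i ≠ k → j ≠ k → ¬ Collinear ℝ {P i, P j, P k}

/-- The ordering `σ` of the labels (label `σ i` has position `i`) is monotone for `P`: there is a
line `{a + t • u}`, `u ≠ 0`, such that the orthogonal projections `a + t i • u` of the points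
`P (σ i)` to this line are met in the order `i = 0, 1, …, n - 1` along the line. -/
def IsMonotoneOrdering {n : ℕ} (P : Fin n → Plane) (σ : Equiv.Perm (Fin n)) : Prop :=
  ∃ a u : Plane, u ≠ 0 ∧ ∃ t : Fin n → ℝ, StrictMono t ∧
    ∀ i, inner ℝ u (P (σ i) - (a + t i • u)) = 0

/-- `σ` gives a pair of compatible monotone paths: it is monotone for `P` and for `Q`. -/
def IsCompatibleMonotone {n : ℕ} (P Q : Fin n → Plane) (σ : Equiv.Perm (Fin n)) : Prop :=
  IsMonotoneOrdering P σ ∧ IsMonotoneOrdering Q σ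

/-! ## The real RAM

Structured programs over a memory with separate integer cells (machine words) and real cells.
Each kind of cell comes as scalar variables and as arrays.  Primitive operations: constants,
reading a cell, `+`, `-`, `*` and comparison, each of unit cost.  There is no conversion between
integers and reals, no rounding, and no division.  Integer subtraction is cut off at `0`. -/

namespace RealRAM

/-- Contents of the memory. -/
@[ext] structure State where
  /-- integer variables -/
  iv : ℕ → ℕ
  /-- real variables -/
  rv : ℕ → ℝ
  /-- integer arrays: `ia a k` is cell `k` of array `a` -/
  ia : ℕ → ℕ → ℕ
  /-- real arrays: `ra a k` is cell `k` of array `a` -/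
  ra : ℕ → ℕ → ℝ

/-- Integer expressions. -/
inductive IExp where
  | const (c : ℕ)
  | var (x : ℕ)
  | get (a : ℕ) (e : IExp)
  | add (e f : IExp)
  | sub (e f : IExp)
  | mul (e f : IExp)

/-- Real expressions.  Only integers are available as constants. -/
inductive RExp where
  | const (c : ℤ)
  | var (x : ℕ)
  | get (a : ℕ) (e : IExp)
  | add (e f : RExp)
  | sub (e f : RExp)
  | mul (e f : RExp)

/-- Tests. -/
inductive BExp where
  | ilt (e f : IExp)
  | rlt (e f : RExp)
  | not (b : BExp)
  | and (b c : BExp)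

/-- Programs. -/
inductive Prog where
  | skip
  | setI (x : ℕ) (e : IExp)
  | setR (x : ℕ) (e : RExp)
  | putI (a : ℕ) (e f : IExp)
  | putR (a : ℕ) (e : IExp) (f : RExp)
  | seq (p q : Prog)
  | ite (b : BExp) (p q : Prog)
  | loop (b : BExp) (p : Prog)

/-- Value of an integer expression. -/
def IExp.eval (s : State) : IExp → ℕ
  | .const c => c
  | .var x => s.iv x
  | .get a e => s.ia a (e.eval s)
  | .add e f => e.eval s + f.eval s
  | .sub e f => e.eval s - f.eval s
  | .mul e f => e.eval s * f.eval s

/-- Value of a real expression. -/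
noncomputable def RExp.eval (s : State) : RExp → ℝ
  | .const c => c
  | .var x => s.rv x
  | .get a e => s.ra a (e.eval s)
  | .add e f => e.eval s + f.eval s
  | .sub e f => e.eval s - f.eval s
  | .mul e f => e.eval s * f.eval s

/-- Truth of a test. -/
def BExp.holds (s : State) : BExp → Prop
  | .ilt e f => e.eval s < f.eval s
  | .rlt e f => e.eval s < f.eval s
  | .not b => ¬ b.holds s
  | .and b c => b.holds s ∧ c.holds s

/-- Number of primitive operations for an integer expression. -/
def IExp.cost : IExp → ℕ
  | .const _ => 1
  | .var _ => 1
  | .get _ e => e.cost + 1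
  | .add e f => e.cost + f.cost + 1
  | .sub e f => e.cost + f.cost + 1
  | .mul e f => e.cost + f.cost + 1

/-- Number of primitive operations for a real expression. -/
def RExp.cost : RExp → ℕ
  | .const _ => 1
  | .var _ => 1
  | .get _ e => e.cost + 1
  | .add e f => e.cost + f.cost + 1
  | .sub e f => e.cost + f.cost + 1
  | .mul e f => e.cost + f.cost + 1

/-- Number of primitive operations for a test. -/
def BExp.cost : BExp → ℕ
  | .ilt e f => e.cost + f.cost + 1
  | .rlt e f => e.cost + f.cost + 1
  | .not b => b.cost + 1
  | .and b c => b.cost + c.cost + 1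

/-- Assign to an integer variable. -/
def State.setI (s : State) (x v : ℕ) : State :=
  { s with iv := Function.update s.iv x v }

/-- Assign to a real variable. -/
def State.setR (s : State) (x : ℕ) (v : ℝ) : State :=
  { s with rv := Function.update s.rv x v }

/-- Write to cell `k` of the integer array `a`. -/
def State.putI (s : State) (a k v : ℕ) : State :=
  { s with ia := Function.update s.ia a (Function.update (s.ia a) k v) }

/-- Write to cell `k` of the real array `a`. -/
def State.putR (s : State) (a k : ℕ) (v : ℝ) : State :=
  { s with ra := Function.update s.ra a (Function.update (s.ra a) k v) }

/-- `Exec W p s s' t`: on a machine whose words hold the integers below `W`, the program `p`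
started in memory state `s` halts in state `s'` after `t` steps.  Storing an integer that does not
fit in a word, or writing to an address that does not fit, is a fault: such a run has no result. -/
inductive Exec (W : ℕ) : Prog → State → State → ℕ → Prop
  | skip (s : State) : Exec W .skip s s 1
  | setI (s : State) (x : ℕ) (e : IExp) (he : e.eval s < W) :
      Exec W (.setI x e) s (s.setI x (e.eval s)) (e.cost + 1)
  | setR (s : State) (x : ℕ) (e : RExp) :
      Exec W (.setR x e) s (s.setR x (e.eval s)) (e.cost + 1)
  | putI (s : State) (a : ℕ) (e f : IExp) (he : e.eval s < W) (hf : f.eval s < W) :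
      Exec W (.putI a e f) s (s.putI a (e.eval s) (f.eval s)) (e.cost + f.cost + 1)
  | putR (s : State) (a : ℕ) (e : IExp) (f : RExp) (he : e.eval s < W) :
      Exec W (.putR a e f) s (s.putR a (e.eval s) (f.eval s)) (e.cost + f.cost + 1)
  | seq {p q : Prog} {s s₁ s₂ : State} {t₁ t₂ : ℕ}
      (hp : Exec W p s s₁ t₁) (hq : Exec W q s₁ s₂ t₂) :
      Exec W (.seq p q) s s₂ (t₁ + t₂)
  | ite_true {b : BExp} {p q : Prog} {s s₁ : State} {t : ℕ}
      (hb : b.holds s) (hp : Exec W p s s₁ t) :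
      Exec W (.ite b p q) s s₁ (b.cost + 1 + t)
  | ite_false {b : BExp} {p q : Prog} {s s₁ : State} {t : ℕ}
      (hb : ¬ b.holds s) (hq : Exec W q s s₁ t) :
      Exec W (.ite b p q) s s₁ (b.cost + 1 + t)
  | loop_true {b : BExp} {p : Prog} {s s₁ s₂ : State} {t₁ t₂ : ℕ}
      (hb : b.holds s) (hp : Exec W p s s₁ t₁) (hl : Exec W (.loop b p) s₁ s₂ t₂) :
      Exec W (.loop b p) s s₂ (b.cost + 1 + t₁ + t₂)
  | loop_false {b : BExp} {p : Prog} {s : State} (hb : ¬ b.holds s) :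
      Exec W (.loop b p) s s (b.cost + 1)

/-- A program has at most one run from a given state, so its result and its number of steps are
determined. -/
theorem Exec.deterministic {W : ℕ} {p : Prog} {s s₁ s₂ : State} {t₁ t₂ : ℕ}
    (h₁ : Exec W p s s₁ t₁) (h₂ : Exec W p s s₂ t₂) : s₁ = s₂ ∧ t₁ = t₂ := by
  induction h₁ generalizing s₂ t₂ with
  | skip | setI | setR | putI | putR => cases h₂; exact ⟨rfl, rfl⟩
  | seq _ _ ih₁ ih₂ =>
    cases h₂ with
    | seq hp hq =>
      obtain ⟨rfl, rfl⟩ := ih₁ hp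
      obtain ⟨rfl, rfl⟩ := ih₂ hq
      exact ⟨rfl, rfl⟩
  | ite_true hb _ ih =>
    cases h₂ with
    | ite_true _ hp => obtain ⟨rfl, rfl⟩ := ih hp; exact ⟨rfl, rfl⟩
    | ite_false hb' _ => exact absurd hb hb'
  | ite_false hb _ ih =>
    cases h₂ with
    | ite_true hb' _ => exact absurd hb' hb
    | ite_false _ hp => obtain ⟨rfl, rfl⟩ := ih hp; exact ⟨rfl, rfl⟩
  | loop_true hb _ _ ih₁ ih₂ =>
    cases h₂ with
    | loop_true _ hp hl =>
      obtain ⟨rfl, rfl⟩ := ih₁ hp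
      obtain ⟨rfl, rfl⟩ := ih₂ hl
      exact ⟨rfl, rfl⟩
    | loop_false hb' => exact absurd hb hb'
  | loop_false hb =>
    cases h₂ with
    | loop_true hb' _ _ => exact absurd hb' hb
    | loop_false _ => exact ⟨rfl, rfl⟩

end RealRAM

/-! ## Input and output -/

/-- Coordinate `c` of the points of `P`, as the contents of a real array. -/
noncomputable def coordArray {n : ℕ} (P : Fin n → Plane) (c : Fin 2) (k : ℕ) : ℝ :=
  if h : k < n then P ⟨k, h⟩ c else 0

/-- The memory at the start: `n` in integer variable `0`, the coordinates of the points of `P` in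
the real arrays `0` and `1`, those of `Q` in the real arrays `2` and `3`, and `0` elsewhere. -/
noncomputable def inputState {n : ℕ} (P Q : Fin n → Plane) : RealRAM.State where
  iv x := if x = 0 then n else 0
  rv _ := 0
  ia _ _ := 0
  ra a k :=
    if a = 0 then coordArray P 0 k
    else if a = 1 then coordArray P 1 k
    else if a = 2 then coordArray Q 0 k
    else if a = 3 then coordArray Q 1 k
    else 0

/-- The final memory holds a correct answer: either integer variable `1` is `1` and integer array
`0` lists an ordering of the labels that is monotone for both sets, or integer variable `1` is `0`
and there is no such ordering. -/
def IsCorrectOutput {n : ℕ} (P Q : Fin n → Plane) (s : RealRAM.State) : Prop :=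
  (s.iv 1 = 1 ∧ ∃ σ : Equiv.Perm (Fin n),
      IsCompatibleMonotone P Q σ ∧ ∀ i : Fin n, s.ia 0 i = σ i) ∨
    (s.iv 1 = 0 ∧ ¬ ∃ σ : Equiv.Perm (Fin n), IsCompatibleMonotone P Q σ)

/-! Order the points p by the value of z × p = z₁p₂ − z₂p₁ for a vector z; by
`isMonotoneOrdering_iff` the strict orderings obtained in this way are the monotone ones. Whether
label a precedes label b is the sign of z × (P_b − P_a). Orient every difference vector so that its
angle lies in [0, π). One of z and −z has its angle there too, and the sign depends only on which
side of that angle the difference vector lies. So a monotone ordering amounts to a cut of the family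
of pairs by angle, at a strict gap, up to reversal (`separates_of_direction`,
`Separates.exists_direction`).

Each pair of labels gives such a vector in P and one in Q, and a type: 0 if both run the same way
between the labels, 1 if they run in opposite ways. A compatible ordering exists iff there are a cut
T for P and some r in {0, 1} such that the pairs e with (T e ↔ t e = r) form a cut for Q; r accounts
for a reversal in one of the two sets only (`IsPairTable.exists_compatible`,
`IsPairTable.exists_separates`).

To find such a cut, sort the at most n² pairs by their angle in P; this is the only part that costs
n² log n. Now T is the set of positions from some k on. For given k and r, each of the two sides
required in Q is the union of a prefix of one type and a suffix of the other type. They are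
separated iff the maxima on one side are less than the minima on the other, and these extremes are
available from eight tables computed by linear scans. Hence each k is tested in constant time
(`matchTest_holds`). From a good cut, the position of a label is the number of labels that precede
it, a column sum of an n × n matrix. Angles are compared by signs of cross products, without
division. -/

namespace RealRAM

/-! ## A program logic with costs -/

/-- From the state `s`, the program `p` halts after at most `T` steps in a state satisfying `Q`. -/
def Runs (W : ℕ) (p : Prog) (s : State) (T : ℕ) (Q : State → Prop) : Prop :=
  ∃ s' t, Exec W p s s' t ∧ t ≤ T ∧ Q s'

theorem Runs.mono {W : ℕ} {p : Prog} {s : State} {T T' : ℕ} {Q Q' : State → Prop}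
    (h : Runs W p s T Q) (hT : T ≤ T') (hQ : ∀ s', Q s' → Q' s') : Runs W p s T' Q' := by
  obtain ⟨s', t, he, ht, hq⟩ := h
  exact ⟨s', t, he, ht.trans hT, hQ _ hq⟩

theorem Runs.seq {W : ℕ} {p q : Prog} {s : State} {T₁ T₂ : ℕ} {R Q : State → Prop}
    (hp : Runs W p s T₁ R) (hq : ∀ s', R s' → Runs W q s' T₂ Q) :
    Runs W (.seq p q) s (T₁ + T₂) Q := by
  obtain ⟨s₁, t₁, he₁, ht₁, h₁⟩ := hp
  obtain ⟨s₂, t₂, he₂, ht₂, h₂⟩ := hq s₁ h₁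
  exact ⟨s₂, t₁ + t₂, .seq he₁ he₂, by omega, h₂⟩

/-- A loop that is executed exactly `m` times, with an invariant that counts the iterations. -/
theorem Runs.loop {W : ℕ} {b : BExp} {p : Prog} {T : ℕ} (Inv : ℕ → State → Prop) (m : ℕ)
    (hstep : ∀ k s, k < m → Inv k s → b.holds s ∧ Runs W p s T (Inv (k + 1)))
    (hend : ∀ s, Inv m s → ¬ b.holds s) {s : State} (h0 : Inv 0 s) :
    Runs W (.loop b p) s (m * (b.cost + 1 + T) + (b.cost + 1)) (Inv m) := by
  have key : ∀ r k s, k + r = m → Inv k s →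
      Runs W (.loop b p) s (r * (b.cost + 1 + T) + (b.cost + 1)) (Inv m) := by
    intro r
    induction r with
    | zero =>
      intro k s hk hs
      obtain rfl : k = m := by omega
      exact ⟨s, _, .loop_false (hend s hs), by omega, hs⟩
    | succ r ih =>
      intro k s hk hs
      obtain ⟨hb, s₁, t₁, he₁, ht₁, h₁⟩ := hstep k s (by omega) hs
      obtain ⟨s₂, t₂, he₂, ht₂, h₂⟩ := ih (k + 1) s₁ (by omega) h₁
      refine ⟨s₂, _, .loop_true hb he₁ he₂, ?_, h₂⟩
      rw [Nat.succ_mul]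
      omega
  exact key m 0 s (by omega) h0

/-- Weakest precondition of a program without loops. -/
def wp (W : ℕ) : Prog → (State → Prop) → State → Prop
  | .skip, Q, s => Q s
  | .setI x e, Q, s => e.eval s < W ∧ Q (s.setI x (e.eval s))
  | .setR x e, Q, s => Q (s.setR x (e.eval s))
  | .putI a e f, Q, s => e.eval s < W ∧ f.eval s < W ∧ Q (s.putI a (e.eval s) (f.eval s))
  | .putR a e f, Q, s => e.eval s < W ∧ Q (s.putR a (e.eval s) (f.eval s))
  | .seq p q, Q, s => wp W p (wp W q Q) s
  | .ite b p q, Q, s => (b.holds s → wp W p Q s) ∧ (¬ b.holds s → wp W q Q s)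
  | .loop _ _, _, _ => False

/-- Bound for the number of steps of a program without loops. -/
def Prog.bound : Prog → ℕ
  | .skip => 1
  | .setI _ e => e.cost + 1
  | .setR _ e => e.cost + 1
  | .putI _ e f => e.cost + f.cost + 1
  | .putR _ e f => e.cost + f.cost + 1
  | .seq p q => p.bound + q.bound
  | .ite b p q => b.cost + 1 + max p.bound q.bound
  | .loop _ _ => 0

/-- The value 0 of `Prog.bound` at a loop is harmless, since `wp` of a loop is `False`; loops are
treated by `Runs.loop`. -/
theorem Runs.of_wp {W : ℕ} {p : Prog} {s : State} {Q : State → Prop} (h : wp W p Q s) :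
    Runs W p s p.bound Q := by
  induction p generalizing s Q with
  | skip => exact ⟨_, _, .skip s, le_rfl, h⟩
  | setI x e => exact ⟨_, _, .setI s x e h.1, le_rfl, h.2⟩
  | setR x e => exact ⟨_, _, .setR s x e, le_rfl, h⟩
  | putI a e f => exact ⟨_, _, .putI s a e f h.1 h.2.1, le_rfl, h.2.2⟩
  | putR a e f => exact ⟨_, _, .putR s a e f h.1, le_rfl, h.2⟩
  | seq p q ihp ihq => exact (ihp h).seq fun _ h' => ihq h'
  | ite b p q ihp ihq =>
    by_cases hb : b.holds s
    · obtain ⟨s', t, he, ht, hq⟩ := ihp (h.1 hb)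
      exact ⟨s', _, .ite_true hb he, by simp only [Prog.bound]; omega, hq⟩
    · obtain ⟨s', t, he, ht, hq⟩ := ihq (h.2 hb)
      exact ⟨s', _, .ite_false hb he, by simp only [Prog.bound]; omega, hq⟩
  | loop => exact h.elim

/-! ### Memory cells after a write -/

@[simp] theorem State.setI_iv (s : State) (x v y : ℕ) :
    (s.setI x v).iv y = if y = x then v else s.iv y := Function.update_apply ..
@[simp] theorem State.setI_rv (s : State) (x v : ℕ) : (s.setI x v).rv = s.rv := rfl
@[simp] theorem State.setI_ia (s : State) (x v : ℕ) : (s.setI x v).ia = s.ia := rfl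
@[simp] theorem State.setI_ra (s : State) (x v : ℕ) : (s.setI x v).ra = s.ra := rfl
@[simp] theorem State.setR_iv (s : State) (x : ℕ) (v : ℝ) : (s.setR x v).iv = s.iv := rfl
@[simp] theorem State.setR_rv (s : State) (x : ℕ) (v : ℝ) (y : ℕ) :
    (s.setR x v).rv y = if y = x then v else s.rv y := Function.update_apply ..
@[simp] theorem State.setR_ia (s : State) (x : ℕ) (v : ℝ) : (s.setR x v).ia = s.ia := rfl
@[simp] theorem State.setR_ra (s : State) (x : ℕ) (v : ℝ) : (s.setR x v).ra = s.ra := rfl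
@[simp] theorem State.putI_iv (s : State) (a k v : ℕ) : (s.putI a k v).iv = s.iv := rfl
@[simp] theorem State.putI_rv (s : State) (a k v : ℕ) : (s.putI a k v).rv = s.rv := rfl
@[simp] theorem State.putI_ia (s : State) (a k v b : ℕ) :
    (s.putI a k v).ia b = if b = a then Function.update (s.ia a) k v else s.ia b :=
  Function.update_apply ..
@[simp] theorem State.putI_ra (s : State) (a k v : ℕ) : (s.putI a k v).ra = s.ra := rfl
@[simp] theorem State.putR_iv (s : State) (a k : ℕ) (v : ℝ) : (s.putR a k v).iv = s.iv := rfl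
@[simp] theorem State.putR_rv (s : State) (a k : ℕ) (v : ℝ) : (s.putR a k v).rv = s.rv := rfl
@[simp] theorem State.putR_ia (s : State) (a k : ℕ) (v : ℝ) : (s.putR a k v).ia = s.ia := rfl
@[simp] theorem State.putR_ra (s : State) (a k : ℕ) (v : ℝ) (b : ℕ) :
    (s.putR a k v).ra b = if b = a then Function.update (s.ra a) k v else s.ra b :=
  Function.update_apply ..

attribute [simp] IExp.eval RExp.eval BExp.holds wp

/-- Sequential composition. -/
infixr:60 " ;; " => Prog.seq

end RealRAM
/-! ## Directions -/

/-- The vector `(x, y)` has its angle in `[0, π)`. -/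
def IsUpper (x y : ℝ) : Prop := 0 < y ∨ y = 0 ∧ 0 < x

theorem isUpper_or_neg {x y : ℝ} (h : ¬ (x = 0 ∧ y = 0)) : IsUpper x y ∨ IsUpper (-x) (-y) := by
  unfold IsUpper
  rcases lt_trichotomy y 0 with hy | hy | hy
  · exact .inr (.inl (by linarith))
  · rcases lt_trichotomy x 0 with hx | hx | hx
    · exact .inr (.inr ⟨by linarith, by linarith⟩)
    · exact absurd ⟨hx, hy⟩ h
    · exact .inl (.inr ⟨hy, hx⟩)
  · exact .inl (.inl hy)

/-- A quantity that increases with the angle of an upper vector. -/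
noncomputable def angleKey (x y : ℝ) : WithBot ℝ := if y = 0 then ⊥ else ((-x / y : ℝ) : WithBot ℝ)

/-- For `y > 0` the key is minus the cotangent of the angle, which increases on (0, π), and `⊥`
stands for the angle 0. The difference of two angles lies in (−π, π), so the cross product has its
sign. -/
theorem cross_pos_iff_angleKey_lt {x y x' y' : ℝ} (h : IsUpper x y) (h' : IsUpper x' y') :
    0 < x * y' - y * x' ↔ angleKey x y < angleKey x' y' := by
  unfold angleKey
  rcases h with h | ⟨rfl, h⟩ <;> rcases h' with h' | ⟨rfl, h'⟩
  · rw [if_neg h.ne', if_neg h'.ne', WithBot.coe_lt_coe, div_lt_div_iff₀ h h']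
    constructor <;> intro <;> nlinarith
  · simp [h.ne', (mul_pos h h').le]
  · simp [h'.ne', h, h']
  · simp

/-- `T` splits the indices below `N` into an initial and a final segment with respect to `κ`. -/
def Separates {α : Type*} [LT α] (N : ℕ) (κ : ℕ → α) (T : ℕ → Prop) : Prop :=
  ∀ e < N, ∀ f < N, ¬ T e → T f → κ e < κ f

theorem Separates.congr {α : Type*} [LT α] {N : ℕ} {κ : ℕ → α} {T T' : ℕ → Prop}
    (h : Separates N κ T) (hT : ∀ e < N, T e ↔ T' e) : Separates N κ T' :=
  fun e he f hf h₁ h₂ => h e he f hf (fun h' => h₁ ((hT e he).1 h')) ((hT f hf).2 h₂)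

/-- Finitely many strict inequalities between angles leave room for a vector z in between, and z × v
is positive exactly for the v beyond it. -/
theorem Separates.exists_direction {N : ℕ} {x y : ℕ → ℝ} {T : ℕ → Prop}
    (hu : ∀ e < N, IsUpper (x e) (y e)) (h : Separates N (fun e => angleKey (x e) (y e)) T) :
    ∃ z₁ z₂ : ℝ, ∀ e < N,
      (T e → 0 < z₁ * y e - z₂ * x e) ∧ (¬ T e → z₁ * y e - z₂ * x e < 0) := by
  classical
  -- No key is less than `⊥`, so a horizontal vector in `T` forces all vectors into `T`.
  by_cases hT : ∃ f < N, T f ∧ y f = 0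
  · obtain ⟨f, hf, hTf, hyf⟩ := hT
    have hall : ∀ e < N, T e := by
      intro e he
      by_contra hne
      have := h e he f hf hne hTf
      simp [angleKey, hyf] at this
    obtain ⟨c, hc, -⟩ := Order.exists_between_finsets
      ((Finset.range N).image fun e => -x e / y e) ∅ (by simp)
    -- All upper vectors of the family lie to the left of `(c, -1)` once `c` exceeds every finite
    -- key.
    refine ⟨c, -1, fun e he => ⟨fun _ => ?_, fun hn => absurd (hall e he) hn⟩⟩
    rcases hu e he with hy | ⟨hy, hx⟩
    · have := hc (-x e / y e) (Finset.mem_image_of_mem _ (Finset.mem_range.2 he))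
      rw [div_lt_iff₀ hy] at this
      linarith
    · rw [hy]; linarith
  · push Not at hT
    obtain ⟨c, hlo, hhi⟩ := Order.exists_between_finsets
      (((Finset.range N).filter fun e => ¬ T e ∧ y e ≠ 0).image fun e => -x e / y e)
      (((Finset.range N).filter fun e => T e).image fun e => -x e / y e) (by
        intro a ha b hb
        simp only [Finset.mem_image, Finset.mem_filter, Finset.mem_range] at ha hb
        obtain ⟨e, ⟨he, hTe, hye⟩, rfl⟩ := ha
        obtain ⟨f, ⟨hf, hTf⟩, rfl⟩ := hb
        have := h e he f hf hTe hTf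
        simpa [angleKey, hye, hT f hf hTf, WithBot.coe_lt_coe] using this)
    -- `(-c, 1)` is an upper vector with key `c`.
    refine ⟨-c, 1, fun e he => ⟨fun ht => ?_, fun hn => ?_⟩⟩
    · have hy : 0 < y e := (hu e he).resolve_right fun h' => hT e he ht h'.1
      have := hhi (-x e / y e) (Finset.mem_image_of_mem _ (by simp [he, ht]))
      rw [lt_div_iff₀ hy] at this
      linarith
    · rcases hu e he with hy | ⟨hy, hx⟩
      · have := hlo (-x e / y e) (Finset.mem_image_of_mem _ (by simp [he, hn, hy.ne']))
        rw [div_lt_iff₀ hy] at this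
        linarith
      · rw [hy]; linarith

/-- An upper z splits the family at its own angle. If −z is upper instead, all signs are reversed
and the complement takes the place of the set. -/
theorem separates_of_direction {N : ℕ} {x y : ℕ → ℝ} (hu : ∀ e < N, IsUpper (x e) (y e))
    {z₁ z₂ : ℝ} (hz : ∀ e < N, z₁ * y e - z₂ * x e ≠ 0) :
    Separates N (fun e => angleKey (x e) (y e)) (fun e => 0 < z₁ * y e - z₂ * x e) ∨
      Separates N (fun e => angleKey (x e) (y e)) (fun e => ¬ 0 < z₁ * y e - z₂ * x e) := by
  by_cases h0 : z₁ = 0 ∧ z₂ = 0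
  · refine .inl fun e he => absurd ?_ (hz e he)
    simp [h0]
  rcases isUpper_or_neg h0 with h | h
  · refine .inl fun e he f hf hTe hTf => ?_
    have h₁ := (cross_pos_iff_angleKey_lt (hu e he) h).1
      (by have := lt_of_le_of_ne (not_lt.1 hTe) (hz e he); linarith)
    exact h₁.trans ((cross_pos_iff_angleKey_lt h (hu f hf)).1 hTf)
  · refine .inr fun e he f hf hTe hTf => ?_
    have h₁ := (cross_pos_iff_angleKey_lt (hu e he) h).1 (by linarith [not_not.1 hTe])
    exact h₁.trans ((cross_pos_iff_angleKey_lt h (hu f hf)).1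
      (by have := lt_of_le_of_ne (not_lt.1 hTf) (hz f hf); linarith))

/-- In a sorted list only the two neighbours of the cut have to be compared. Cuts before the first
and after the last element impose no condition. -/
theorem separates_iff_of_monotone {α : Type*} [LinearOrder α] {N : ℕ} {κ : ℕ → α}
    (hκ : ∀ i j, i ≤ j → j < N → κ i ≤ κ j) {k : ℕ} :
    Separates N κ (fun j => k ≤ j) ↔ (0 < k → k < N → κ (k - 1) < κ k) := by
  constructor
  · intro h h0 hk
    exact h _ (by omega) _ hk (by omega) le_rfl
  · intro h e he f hf h₁ h₂
    have := h (by omega) (by omega)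
    exact ((hκ e (k - 1) (by omega) (by omega)).trans_lt this).trans_le (hκ k f h₂ hf)

/-- A separated set is closed upwards in the sorted list, so the cut is at its first element, or at
`N` if it is empty. -/
theorem Separates.exists_cut {α : Type*} [LinearOrder α] {N : ℕ} {κ : ℕ → α} {T : ℕ → Prop}
    (hκ : ∀ i j, i ≤ j → j < N → κ i ≤ κ j) (h : Separates N κ T) :
    ∃ k ≤ N, ∀ j < N, T j ↔ k ≤ j := by
  classical
  by_cases hT : ∃ j, j < N ∧ T j
  · refine ⟨Nat.find hT, (Nat.find_spec hT).1.le, fun j hj => ⟨fun h' => Nat.find_le ⟨hj, h'⟩, ?_⟩⟩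
    intro hle
    by_contra hn
    exact absurd (h j hj _ (Nat.find_spec hT).1 hn (Nat.find_spec hT).2) (hκ _ _ hle hj).not_gt
  · push Not at hT
    exact ⟨N, le_rfl, fun j hj => ⟨fun h' => absurd h' (hT j hj), fun h' => absurd hj h'.not_gt⟩⟩

/-! ## Monotone orderings -/

/-- Projection to a line of direction u is, up to scaling and shift, the functional z × p for z =
(u₁, −u₀), which is u turned by a right angle. -/
theorem isMonotoneOrdering_iff {n : ℕ} {P : Fin n → Plane} {σ : Equiv.Perm (Fin n)} :
    IsMonotoneOrdering P σ ↔
      ∃ z₁ z₂ : ℝ, StrictMono fun i => z₁ * P (σ i) 1 - z₂ * P (σ i) 0 := by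
  constructor
  · rintro ⟨a, u, hu, t, ht, h⟩
    have hpos : 0 < u 0 * u 0 + u 1 * u 1 := by
      by_contra hn
      apply hu
      have h0 : u 0 = 0 := by nlinarith [mul_self_nonneg (u 0), mul_self_nonneg (u 1)]
      have h1 : u 1 = 0 := by nlinarith [mul_self_nonneg (u 0), mul_self_nonneg (u 1)]
      ext i
      fin_cases i <;> simp [h0, h1]
    refine ⟨u 1, -u 0, fun i j hij => ?_⟩
    have hi := h i
    have hj := h j
    simp [PiLp.inner_apply, Fin.sum_univ_two] at hi hj
    have := mul_pos hpos (sub_pos.2 (ht hij))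
    dsimp only
    nlinarith
  · rintro ⟨z₁, z₂, h⟩
    rcases Nat.lt_or_ge 1 n with hn | hn
    · have h01 := h (show (⟨0, by omega⟩ : Fin n) < ⟨1, hn⟩ by simp)
      have hz : z₁ ≠ 0 ∨ z₂ ≠ 0 := by
        by_contra hc
        push Not at hc
        simp [hc.1, hc.2] at h01
      have hpos : 0 < z₁ * z₁ + z₂ * z₂ := by
        rcases hz with hz | hz
        · nlinarith [mul_self_pos.2 hz, mul_self_nonneg z₂]
        · nlinarith [mul_self_pos.2 hz, mul_self_nonneg z₁]
      refine ⟨0, !₂[-z₂, z₁], ?_,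
        fun i => (z₁ * P (σ i) 1 - z₂ * P (σ i) 0) / (z₁ * z₁ + z₂ * z₂), ?_, ?_⟩
      · intro h0
        have e0 := congrArg (fun v : Plane => v 0) h0
        have e1 := congrArg (fun v : Plane => v 1) h0
        simp at e0 e1
        simp [e0, e1] at hz
      · exact fun i j hij => div_lt_div_of_pos_right (h hij) hpos
      · intro i
        simp [PiLp.inner_apply, Fin.sum_univ_two]
        have hne : z₁ ^ 2 + z₂ ^ 2 ≠ 0 := by nlinarith
        rw [← sq, ← sq]
        field_simp
        ring
    -- With at most one label z may be zero, so a line is chosen through the only point.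
    · have hs : Subsingleton (Fin n) := Fin.subsingleton_iff_le_one.2 hn
      refine ⟨if h : 0 < n then P ⟨0, h⟩ else 0, !₂[1, 0], ?_, fun _ => 0, ?_, ?_⟩
      · intro h0
        have e0 := congrArg (fun v : Plane => v 0) h0
        simp at e0
      · intro i j hij
        exact absurd (Subsingleton.elim i j) hij.ne
      · intro i
        have hn' : 0 < n := i.pos
        have : σ i = ⟨0, hn'⟩ := Subsingleton.elim _ _
        simp [hn', this]

/-- The number of labels with a smaller value of `f`. -/
noncomputable def labelRank {n : ℕ} (f : Fin n → ℝ) (c : Fin n) : ℕ :=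
  (Finset.univ.filter fun c' => f c' < f c).card

theorem labelRank_lt {n : ℕ} (f : Fin n → ℝ) (c : Fin n) : labelRank f c < n := by
  have : (Finset.univ.filter fun c' => f c' < f c) ⊂ Finset.univ :=
    Finset.filter_ssubset.2 ⟨c, Finset.mem_univ c, lt_irrefl _⟩
  simpa [labelRank] using Finset.card_lt_card this

theorem labelRank_lt_labelRank {n : ℕ} {f : Fin n → ℝ} {c c' : Fin n} (h : f c < f c') :
    labelRank f c < labelRank f c' := by
  apply Finset.card_lt_card
  rw [Finset.ssubset_iff_of_subset]
  · exact ⟨c, by simpa using h, by simp⟩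
  · intro x hx
    simp only [Finset.mem_filter, Finset.mem_univ, true_and] at hx ⊢
    exact hx.trans h

theorem labelRank_injective {n : ℕ} {f : Fin n → ℝ} (hf : Function.Injective f) :
    Function.Injective (labelRank f) := by
  intro c c' h
  by_contra hne
  rcases lt_or_gt_of_ne (hf.ne hne) with h' | h'
  · exact (labelRank_lt_labelRank h').ne h
  · exact (labelRank_lt_labelRank h').ne' h

/-- Sorting the labels by their rank makes `f` increasing. -/
theorem exists_perm_strictMono {n : ℕ} {f : Fin n → ℝ} (hf : Function.Injective f) :
    ∃ σ : Equiv.Perm (Fin n), (StrictMono fun i => f (σ i)) ∧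
      ∀ c, ((σ.symm c : Fin n) : ℕ) = labelRank f c := by
  let g : Fin n → Fin n := fun c => ⟨labelRank f c, labelRank_lt f c⟩
  have hg : Function.Bijective g :=
    Finite.injective_iff_bijective.1 fun c c' h => labelRank_injective hf (Fin.mk.inj h)
  refine ⟨(Equiv.ofBijective g hg).symm, fun i j hij => ?_, fun c => rfl⟩
  set e := Equiv.ofBijective g hg
  have key : ∀ i, ((i : Fin n) : ℕ) = labelRank f (e.symm i) := fun i => by
    conv_lhs => rw [← e.apply_symm_apply i]
    rfl
  rcases lt_trichotomy (f (e.symm i)) (f (e.symm j)) with h | h | h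
  · exact h
  · exact absurd (e.symm.injective (hf h)) hij.ne
  · have := labelRank_lt_labelRank h
    rw [← key, ← key] at this
    exact absurd hij (Fin.lt_def.not.2 (by omega))
/-! ## Tables of pairs -/

/-- The entries `e < N` of the table are pairs `(a e, b e)` of labels for which the vector
`(dx e, dy e)` from the first point of the first set to the second one is upper; `(ex e, ey e)` is
the upper one of the two vectors that join the points of the second set, and `t e` tells whether it
is reversed. All pairs `(a, b)` of this kind with `a * n + b < m` are present. -/
structure IsPairTable (n : ℕ) (px py qx qy : ℕ → ℝ) (m N : ℕ) (a b t : ℕ → ℕ)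
    (dx dy ex ey : ℕ → ℝ) : Prop where
  a_lt : ∀ e < N, a e < n
  b_lt : ∀ e < N, b e < n
  dx_eq : ∀ e < N, dx e = px (b e) - px (a e)
  dy_eq : ∀ e < N, dy e = py (b e) - py (a e)
  upper : ∀ e < N, IsUpper (dx e) (dy e)
  upper' : ∀ e < N, IsUpper (ex e) (ey e)
  type : ∀ e < N, (t e = 0 ∧ ex e = qx (b e) - qx (a e) ∧ ey e = qy (b e) - qy (a e)) ∨
    (t e = 1 ∧ ex e = qx (a e) - qx (b e) ∧ ey e = qy (a e) - qy (b e))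
  cover : ∀ c < n, ∀ c' < n, c * n + c' < m → IsUpper (px c' - px c) (py c' - py c) →
    ∃ e < N, a e = c ∧ b e = c'

/-- Used to pass to the sorted order; repetitions would do no harm, but `cover` needs every entry to
be hit. -/
theorem IsPairTable.comp {n : ℕ} {px py qx qy : ℕ → ℝ} {m N : ℕ} {a b t : ℕ → ℕ}
    {dx dy ex ey : ℕ → ℝ} (h : IsPairTable n px py qx qy m N a b t dx dy ex ey) {o : ℕ → ℕ}
    (ho : ∀ j < N, o j < N) (hs : ∀ e < N, ∃ j < N, o j = e) :
    IsPairTable n px py qx qy m N (a ∘ o) (b ∘ o) (t ∘ o) (dx ∘ o) (dy ∘ o) (ex ∘ o) (ey ∘ o) where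
  a_lt j hj := h.a_lt _ (ho j hj)
  b_lt j hj := h.b_lt _ (ho j hj)
  dx_eq j hj := h.dx_eq _ (ho j hj)
  dy_eq j hj := h.dy_eq _ (ho j hj)
  upper j hj := h.upper _ (ho j hj)
  upper' j hj := h.upper' _ (ho j hj)
  type j hj := h.type _ (ho j hj)
  cover c hc c' hc' hm hu := by
    obtain ⟨e, he, h₁, h₂⟩ := h.cover c hc c' hc' hm hu
    obtain ⟨j, hj, rfl⟩ := hs e he
    exact ⟨j, hj, h₁, h₂⟩

@[simp] theorem coordArray_val {n : ℕ} (P : Fin n → Plane) (i : Fin 2) (c : Fin n) :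
    coordArray P i c = P c i := by
  simp [coordArray]

/-- `c` precedes `c'` when the pairs in `T` keep their orientation and the others are reversed. -/
def Precedes (N : ℕ) (a b : ℕ → ℕ) (T : ℕ → Prop) (c c' : ℕ) : Prop :=
  ∃ e < N, (T e ∧ a e = c ∧ b e = c') ∨ (¬ T e ∧ b e = c ∧ a e = c')

section
variable {n : ℕ} {P Q : Fin n → Plane} {N : ℕ} {a b t : ℕ → ℕ} {dx dy ex ey : ℕ → ℝ}

theorem plane_sub_ne {P : Fin n → Plane} (hP : Function.Injective P) {c c' : Fin n} (h : c ≠ c') :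
    ¬ (P c' 0 - P c 0 = 0 ∧ P c' 1 - P c 1 = 0) := by
  rintro ⟨h0, h1⟩
  apply h
  apply hP
  ext i
  fin_cases i
  · exact (sub_eq_zero.1 h0).symm
  · exact (sub_eq_zero.1 h1).symm

/-- One of the two opposite difference vectors of distinct points is upper, so every unordered pair
of labels occurs. -/
theorem IsPairTable.exists_pair (hP : Function.Injective P)
    (h : IsPairTable n (coordArray P 0) (coordArray P 1) (coordArray Q 0) (coordArray Q 1) (n * n) N
      a b t dx dy ex ey) {c c' : Fin n} (hc : c ≠ c') :
    ∃ e < N, (a e = c ∧ b e = c') ∨ (a e = c' ∧ b e = c) := by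
  have hlt : ∀ c c' : Fin n, (c : ℕ) * n + c' < n * n := fun c c' => by
    have := c.2; have := c'.2
    nlinarith [Nat.mul_le_mul_right n (Nat.succ_le_of_lt c.2)]
  rcases isUpper_or_neg (plane_sub_ne hP hc) with hu | hu
  · obtain ⟨e, he, h₁⟩ := h.cover c c.2 c' c'.2 (hlt _ _) (by simpa using hu)
    exact ⟨e, he, .inl h₁⟩
  · obtain ⟨e, he, h₁⟩ := h.cover c' c'.2 c c.2 (hlt _ _) (by simpa using hu)
    exact ⟨e, he, .inr h₁⟩

/-- From splittings of both families of directions that agree on the pairs we get an ordering. -/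
theorem IsPairTable.exists_compatible (hP : Function.Injective P)
    (h : IsPairTable n (coordArray P 0) (coordArray P 1) (coordArray Q 0) (coordArray Q 1) (n * n) N
      a b t dx dy ex ey) {T : ℕ → Prop} {r : ℕ} (hr : r < 2)
    (hT : Separates N (fun e => angleKey (dx e) (dy e)) T)
    (hT' : Separates N (fun e => angleKey (ex e) (ey e)) (fun e => T e ↔ t e = r)) :
    ∃ (f : Fin n → ℝ) (σ : Equiv.Perm (Fin n)), IsCompatibleMonotone P Q σ ∧
      (∀ c, ((σ.symm c : Fin n) : ℕ) = labelRank f c) ∧ Function.Injective (labelRank f) ∧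
      ∀ c c' : Fin n, f c < f c' ↔ Precedes N a b T c c' := by
  obtain ⟨z₁, z₂, hz⟩ := hT.exists_direction h.upper
  obtain ⟨w₁, w₂, hw⟩ := hT'.exists_direction h.upper'
  set f : Fin n → ℝ := fun c => z₁ * P c 1 - z₂ * P c 0 with hf
  have hfe : ∀ e < N, ∀ c c' : Fin n, a e = c → b e = c' →
      (T e → f c < f c') ∧ (¬ T e → f c' < f c) := by
    intro e he c c' hc hc'
    have := hz e he
    rw [h.dx_eq e he, h.dy_eq e he, hc, hc'] at this
    simp only [coordArray_val] at this
    exact ⟨fun ht => by simp only [hf]; linarith [this.1 ht],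
      fun ht => by simp only [hf]; linarith [this.2 ht]⟩
  -- For `r = 1` the direction w orders the second set in the opposite way, so −w is used.
  have hge : ∃ v₁ v₂ : ℝ, ∀ e < N, ∀ c c' : Fin n, a e = c → b e = c' →
      (T e → v₁ * Q c 1 - v₂ * Q c 0 < v₁ * Q c' 1 - v₂ * Q c' 0) ∧
      (¬ T e → v₁ * Q c' 1 - v₂ * Q c' 0 < v₁ * Q c 1 - v₂ * Q c 0) := by
    have hsign : ∀ e < N, ∀ c c' : Fin n, a e = c → b e = c' →
        (T e → 0 < (if r = 0 then 1 else -1) * (w₁ * (Q c' 1 - Q c 1) - w₂ * (Q c' 0 - Q c 0))) ∧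
        (¬ T e → (if r = 0 then 1 else -1) * (w₁ * (Q c' 1 - Q c 1) - w₂ * (Q c' 0 - Q c 0)) < 0) := by
      intro e he c c' hc hc'
      have := hw e he
      rcases h.type e he with ⟨h0, h1, h2⟩ | ⟨h0, h1, h2⟩ <;>
      · rw [h1, h2, hc, hc', h0] at this
        simp only [coordArray_val] at this
        interval_cases r <;> simp at this ⊢ <;> constructor <;> intro ht <;> simp [ht] at this <;>
          linarith
    refine ⟨(if r = 0 then 1 else -1) * w₁, (if r = 0 then 1 else -1) * w₂,
      fun e he c c' hc hc' => ?_⟩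
    have := hsign e he c c' hc hc'
    exact ⟨fun ht => by linarith [this.1 ht], fun ht => by linarith [this.2 ht]⟩
  obtain ⟨v₁, v₂, hv⟩ := hge
  have hiff : ∀ c c' : Fin n, f c < f c' ↔ Precedes N a b T c c' := by
    intro c c'
    constructor
    · intro hlt
      have hne : c ≠ c' := by rintro rfl; exact lt_irrefl _ hlt
      obtain ⟨e, he, ⟨h₁, h₂⟩ | ⟨h₁, h₂⟩⟩ := h.exists_pair hP hne
      · refine ⟨e, he, .inl ⟨?_, h₁, h₂⟩⟩
        by_contra ht
        exact lt_asymm hlt ((hfe e he _ _ h₁ h₂).2 ht)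
      · exact ⟨e, he, .inr ⟨fun ht => lt_asymm hlt ((hfe e he _ _ h₁ h₂).1 ht), h₂, h₁⟩⟩
    · rintro ⟨e, he, ⟨ht, h₁, h₂⟩ | ⟨ht, h₁, h₂⟩⟩
      · exact (hfe e he _ _ h₁ h₂).1 ht
      · exact (hfe e he _ _ h₂ h₁).2 ht
  have hinj : Function.Injective f := by
    intro c c' hcc
    by_contra hne
    obtain ⟨e, he, ⟨h₁, h₂⟩ | ⟨h₁, h₂⟩⟩ := h.exists_pair hP hne <;>
    · by_cases ht : T e
      · have := (hfe e he _ _ h₁ h₂).1 ht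
        rw [hcc] at this
        exact lt_irrefl _ this
      · have := (hfe e he _ _ h₁ h₂).2 ht
        rw [hcc] at this
        exact lt_irrefl _ this
  obtain ⟨σ, hσ, hrank⟩ := exists_perm_strictMono hinj
  refine ⟨f, σ, ⟨isMonotoneOrdering_iff.2 ⟨z₁, z₂, hσ⟩, isMonotoneOrdering_iff.2 ⟨v₁, v₂, ?_⟩⟩,
    hrank, labelRank_injective hinj, hiff⟩
  intro i j hij
  obtain ⟨e, he, ⟨ht, h₁, h₂⟩ | ⟨ht, h₁, h₂⟩⟩ := (hiff _ _).1 (hσ hij)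
  · exact (hv e he _ _ h₁ h₂).1 ht
  · exact (hv e he _ _ h₂ h₁).2 ht

/-- This is the converse of `IsPairTable.exists_compatible`: the two directions that realize an
ordering give equal signs on each pair, up to the type of the pair. -/
theorem IsPairTable.exists_separates
    (h : IsPairTable n (coordArray P 0) (coordArray P 1) (coordArray Q 0) (coordArray Q 1) (n * n) N
      a b t dx dy ex ey) {σ : Equiv.Perm (Fin n)} (hσ : IsCompatibleMonotone P Q σ) :
    ∃ T : ℕ → Prop, ∃ r < 2, Separates N (fun e => angleKey (dx e) (dy e)) T ∧
      Separates N (fun e => angleKey (ex e) (ey e)) (fun e => T e ↔ t e = r) := by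
  obtain ⟨z₁, z₂, hz⟩ := isMonotoneOrdering_iff.1 hσ.1
  obtain ⟨w₁, w₂, hw⟩ := isMonotoneOrdering_iff.1 hσ.2
  have hz' : ∀ c c' : Fin n, z₁ * P c 1 - z₂ * P c 0 < z₁ * P c' 1 - z₂ * P c' 0 ↔
      σ.symm c < σ.symm c' := fun c c' => by
    simpa using hz.lt_iff_lt (a := σ.symm c) (b := σ.symm c')
  have hw' : ∀ c c' : Fin n, w₁ * Q c 1 - w₂ * Q c 0 < w₁ * Q c' 1 - w₂ * Q c' 0 ↔
      σ.symm c < σ.symm c' := fun c c' => by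
    simpa using hw.lt_iff_lt (a := σ.symm c) (b := σ.symm c')
  have hpair : ∀ e < N, ∃ c c' : Fin n, a e = c ∧ b e = c' ∧ c ≠ c' := by
    intro e he
    refine ⟨⟨a e, h.a_lt e he⟩, ⟨b e, h.b_lt e he⟩, rfl, rfl, fun heq => ?_⟩
    have hab : a e = b e := Fin.mk.inj heq
    have := h.upper e he
    rw [h.dx_eq e he, h.dy_eq e he, hab] at this
    simp [IsUpper] at this
  have hor : ∀ c c' : Fin n, c ≠ c' → (σ.symm c' < σ.symm c ↔ ¬ σ.symm c < σ.symm c') := by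
    intro c c' hne
    have := σ.symm.injective.ne hne
    constructor
    · exact fun h h' => lt_asymm h h'
    · exact fun h' => lt_of_le_of_ne (not_lt.1 h') this.symm
  have hP1 : ∀ e < N, ∀ c c' : Fin n, a e = c → b e = c' →
      (0 < z₁ * dy e - z₂ * dx e ↔ σ.symm c < σ.symm c') ∧
      (z₁ * dy e - z₂ * dx e < 0 ↔ σ.symm c' < σ.symm c) := by
    intro e he c c' hc hc'
    rw [h.dx_eq e he, h.dy_eq e he, hc, hc', ← hz' c c', ← hz' c' c]
    simp only [coordArray_val]
    constructor <;> constructor <;> intro <;> linarith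
  have hQ1 : ∀ e < N, ∀ c c' : Fin n, a e = c → b e = c' →
      (0 < w₁ * ey e - w₂ * ex e ↔ (σ.symm c < σ.symm c' ↔ t e = 0)) ∧
      w₁ * ey e - w₂ * ex e ≠ 0 := by
    intro e he c c' hc hc'
    have hne : c ≠ c' := by
      obtain ⟨d, d', h₁, h₂, h₃⟩ := hpair e he
      rintro rfl
      exact h₃ (Fin.ext (by omega))
    rcases h.type e he with ⟨h0, h1, h2⟩ | ⟨h0, h1, h2⟩
    · have e1 := hw' c c'
      have e2 := hw' c' c
      rw [hor c c' hne] at e2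
      rw [h1, h2, h0, hc, hc']
      simp only [coordArray_val, iff_true]
      rw [← e1] at e2 ⊢
      refine ⟨by constructor <;> intro <;> linarith, fun h0 => ?_⟩
      by_cases hlt : w₁ * Q c 1 - w₂ * Q c 0 < w₁ * Q c' 1 - w₂ * Q c' 0
      · linarith
      · linarith [e2.2 hlt]
    · have e1 := hw' c c'
      have e2 := hw' c' c
      rw [hor c c' hne] at e2
      rw [h1, h2, h0, hc, hc']
      simp only [coordArray_val, one_ne_zero, iff_false]
      rw [← e2]
      rw [← e1] at e2
      refine ⟨by constructor <;> intro <;> linarith, fun h0 => ?_⟩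
      by_cases hlt : w₁ * Q c 1 - w₂ * Q c 0 < w₁ * Q c' 1 - w₂ * Q c' 0
      · linarith
      · linarith [e2.2 hlt]
  have hP2 : ∀ e < N, z₁ * dy e - z₂ * dx e ≠ 0 := by
    intro e he h0
    obtain ⟨c, c', hc, hc', hne⟩ := hpair e he
    have := hP1 e he c c' hc hc'
    rw [hor c c' hne] at this
    by_cases hlt : σ.symm c < σ.symm c'
    · linarith [this.1.2 hlt]
    · linarith [this.2.2 hlt]
  have hlink : ∀ e < N, (0 < w₁ * ey e - w₂ * ex e ↔ (0 < z₁ * dy e - z₂ * dx e ↔ t e = 0)) := by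
    intro e he
    obtain ⟨c, c', hc, hc', -⟩ := hpair e he
    rw [(hQ1 e he c c' hc hc').1, (hP1 e he c c' hc hc').1]
  have ht01 : ∀ e < N, t e = 0 ∨ t e = 1 := fun e he =>
    (h.type e he).imp (fun h => h.1) fun h => h.1
  have hQ2 : ∀ e < N, w₁ * ey e - w₂ * ex e ≠ 0 := by
    intro e he
    obtain ⟨c, c', hc, hc', -⟩ := hpair e he
    exact (hQ1 e he c c' hc hc').2
  -- Reversing both directions or none gives `r = 0`; a single reversal gives `r = 1`.
  rcases separates_of_direction h.upper hP2 with h₁ | h₁ <;>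
    rcases separates_of_direction h.upper' hQ2 with h₂ | h₂
  · refine ⟨_, 0, by norm_num, h₁, h₂.congr hlink⟩
  · refine ⟨_, 1, by norm_num, h₁, h₂.congr fun e he => ?_⟩
    rw [hlink e he]
    rcases ht01 e he with h | h <;> simp [h]
  · refine ⟨_, 1, by norm_num, h₁, h₂.congr fun e he => ?_⟩
    rw [hlink e he]
    rcases ht01 e he with h | h <;> simp [h]
  · refine ⟨_, 0, by norm_num, h₁, h₂.congr fun e he => ?_⟩
    rw [hlink e he]
    rcases ht01 e he with h | h <;> simp [h]
end
-- Building the table of pairs one ordered pair at a time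
theorem eq_and_eq_of_mul_add_eq {n c c' d d' : ℕ} (hc : c' < n) (hd : d' < n)
    (h : d * n + d' = c * n + c') : d = c ∧ d' = c' := by
  rcases lt_trichotomy d c with hlt | rfl | hlt
  · have := Nat.mul_le_mul_right n (Nat.succ_le_of_lt hlt)
    rw [Nat.succ_mul] at this
    omega
  · exact ⟨rfl, by omega⟩
  · have := Nat.mul_le_mul_right n (Nat.succ_le_of_lt hlt)
    rw [Nat.succ_mul] at this
    omega

section
variable {n : ℕ} {px py qx qy : ℕ → ℝ} {N : ℕ} {a b t : ℕ → ℕ} {dx dy ex ey : ℕ → ℝ}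

theorem IsPairTable.zero : IsPairTable n px py qx qy 0 0 a b t dx dy ex ey := by
  constructor <;> intros <;> omega

theorem IsPairTable.step_of_not_upper {c c' : ℕ}
    (h : IsPairTable n px py qx qy (c * n + c') N a b t dx dy ex ey) (hc' : c' < n)
    (hu : ¬ IsUpper (px c' - px c) (py c' - py c)) :
    IsPairTable n px py qx qy (c * n + (c' + 1)) N a b t dx dy ex ey :=
  { h with
    cover := fun d hd d' hd' hm hu' => by
      rcases Nat.lt_or_ge (d * n + d') (c * n + c') with hlt | hge
      · exact h.cover d hd d' hd' hlt hu'
      · obtain ⟨rfl, rfl⟩ := eq_and_eq_of_mul_add_eq hc' hd' (show d * n + d' = c * n + c' by omega)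
        exact absurd hu' hu }

/-- Since `c * n + c'` determines `c` and `c'`, raising the bound by one adds a single pair to be
covered, the new entry. -/
theorem IsPairTable.push {c c' : ℕ}
    (h : IsPairTable n px py qx qy (c * n + c') N a b t dx dy ex ey) (hc : c < n) (hc' : c' < n)
    (hu : IsUpper (px c' - px c) (py c' - py c)) {tv : ℕ} {x y : ℝ} (hu' : IsUpper x y)
    (ht : (tv = 0 ∧ x = qx c' - qx c ∧ y = qy c' - qy c) ∨
      (tv = 1 ∧ x = qx c - qx c' ∧ y = qy c - qy c')) :
    IsPairTable n px py qx qy (c * n + (c' + 1)) (N + 1) (Function.update a N c)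
      (Function.update b N c') (Function.update t N tv) (Function.update dx N (px c' - px c))
      (Function.update dy N (py c' - py c)) (Function.update ex N x) (Function.update ey N y) := by
  constructor
  case cover =>
    intro d hd d' hd' hm hud
    rcases Nat.lt_or_ge (d * n + d') (c * n + c') with hlt | hge
    · obtain ⟨e, he, h₁, h₂⟩ := h.cover d hd d' hd' hlt hud
      exact ⟨e, by omega, by simp [Function.update_of_ne he.ne, h₁],
        by simp [Function.update_of_ne he.ne, h₂]⟩
    · obtain ⟨rfl, rfl⟩ := eq_and_eq_of_mul_add_eq hc' hd' (show d * n + d' = c * n + c' by omega)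
      exact ⟨N, by omega, by simp, by simp⟩
  all_goals
    intro e he
    rcases Nat.lt_succ_iff_lt_or_eq.1 he with he | rfl
    · simp only [Function.update_of_ne he.ne]
      first
        | exact h.a_lt e he
        | exact h.b_lt e he
        | exact h.dx_eq e he
        | exact h.dy_eq e he
        | exact h.upper e he
        | exact h.upper' e he
        | exact h.type e he
    · simp only [Function.update_self] <;> first
        | exact hc
        | exact hc'
        | exact hu
        | exact hu'
        | exact ht
end

/-! ### The program for the table of pairs -/

namespace RealRAM

/-- Test whether a vector is upper. -/
def upperTest (x y : RExp) : BExp :=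
  .not (.and (.not (.rlt (.const 0) y)) (.not (.and (.not (.rlt y (.const 0))) (.rlt (.const 0) x))))

@[simp] theorem upperTest_holds {s : State} {x y : RExp} :
    (upperTest x y).holds s ↔ IsUpper (x.eval s) (y.eval s) := by
  simp only [upperTest, BExp.holds, IsUpper, RExp.eval, Int.cast_zero]
  constructor
  · intro h
    by_contra hn
    push Not at hn
    exact h ⟨hn.1.not_gt, fun h' => (hn.2 (le_antisymm hn.1 (not_lt.1 h'.1))).not_gt h'.2⟩
  · rintro (h | ⟨h, h'⟩) ⟨h₁, h₂⟩
    · exact h₁ h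
    · exact h₂ ⟨by rw [h]; exact lt_irrefl _, h'⟩

/-- Append the pair in the integer variables `4`, `5` to the table if it is upper. -/
def pairBody : Prog :=
  .setR 0 (.sub (.get 0 (.var 5)) (.get 0 (.var 4))) ;;
  .setR 1 (.sub (.get 1 (.var 5)) (.get 1 (.var 4))) ;;
  .setR 2 (.sub (.get 2 (.var 5)) (.get 2 (.var 4))) ;;
  .setR 3 (.sub (.get 3 (.var 5)) (.get 3 (.var 4))) ;;
  .ite (upperTest (.var 0) (.var 1))
    (.putI 1 (.var 2) (.var 4) ;;
      .putI 2 (.var 2) (.var 5) ;;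
      .putI 4 (.var 2) (.var 2) ;;
      .putR 4 (.var 2) (.var 0) ;;
      .putR 5 (.var 2) (.var 1) ;;
      .ite (upperTest (.var 2) (.var 3))
        (.putI 3 (.var 2) (.const 0) ;;
          .putR 6 (.var 2) (.var 2) ;;
          .putR 7 (.var 2) (.var 3))
        (.putI 3 (.var 2) (.const 1) ;;
          .putR 6 (.var 2) (.sub (.const 0) (.var 2)) ;;
          .putR 7 (.var 2) (.sub (.const 0) (.var 3))) ;;
      .setI 2 (.add (.var 2) (.const 1)))
    .skip ;;
  .setI 5 (.add (.var 5) (.const 1))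

/-- Compute the table of pairs. -/
def pairProg : Prog :=
  .loop (.ilt (.var 4) (.var 0))
    (.setI 5 (.const 0) ;;
      .loop (.ilt (.var 5) (.var 0)) pairBody ;;
      .setI 4 (.add (.var 4) (.const 1)))

/-- The state after the first `m` ordered pairs have been treated. -/
structure PairInv (n : ℕ) (px py qx qy : ℕ → ℝ) (m : ℕ) (s : State) : Prop where
  n_eq : s.iv 0 = n
  found : s.iv 1 = 0
  cut : s.iv 3 = 0
  card_le : s.iv 2 ≤ m
  px_eq : s.ra 0 = px
  py_eq : s.ra 1 = py
  qx_eq : s.ra 2 = qx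
  qy_eq : s.ra 3 = qy
  mat : ∀ x, s.ia 6 x = 0
  ord : ∀ e < s.iv 2, s.ia 4 e = e
  table : IsPairTable n px py qx qy m (s.iv 2) (s.ia 1) (s.ia 2) (s.ia 3) (s.ra 4) (s.ra 5)
    (s.ra 6) (s.ra 7)

theorem PairInv.body {n : ℕ} {px py qx qy : ℕ → ℝ} {W : ℕ} (hW : 8 * (n + 2) ^ 2 ≤ W)
    (hq : ∀ c < n, ∀ c' < n, c ≠ c' → ¬ (qx c' - qx c = 0 ∧ qy c' - qy c = 0)) {c c' : ℕ}
    (hc : c < n) (hc' : c' < n) {s : State} (h : PairInv n px py qx qy (c * n + c') s)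
    (h4 : s.iv 4 = c) (h5 : s.iv 5 = c') :
    Runs W pairBody s pairBody.bound fun s' =>
      PairInv n px py qx qy (c * n + (c' + 1)) s' ∧ s'.iv 4 = c ∧ s'.iv 5 = c' + 1 := by
  have hm : c * n + c' < n * n := by nlinarith [Nat.mul_le_mul_right n (Nat.succ_le_of_lt hc)]
  have hN := h.card_le
  have hW1 : n * n + n + 2 < W := by nlinarith
  apply Runs.of_wp
  simp only [pairBody, wp, IExp.eval, RExp.eval, State.setR_ra, State.setR_rv, State.setR_iv,
    State.setI_iv, State.putI_iv, State.putR_iv, upperTest_holds, State.putI_rv, State.putR_rv,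
    h4, h5, h.px_eq, h.py_eq, h.qx_eq, h.qy_eq]
  norm_num
  have hN' : s.iv 2 < W := by omega
  refine ⟨fun hu => ⟨by omega, by omega, by omega, by omega, by omega, fun hu' => ?_, fun hu' => ?_⟩,
    fun hu => ?_⟩
  · refine ⟨hN', by omega, hN', by omega, by omega, ?_⟩
    have ht := h.table.push hc hc' hu hu' (tv := 0) (.inl ⟨rfl, rfl, rfl⟩)
    constructor <;> try simp [h.n_eq, h.found, h.px_eq, h.py_eq, h.qx_eq, h.qy_eq, h.mat, h.cut]
    · omega
    · intro e he
      rcases Nat.lt_or_eq_of_le he with he | rfl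
      · rw [Function.update_of_ne he.ne, h.ord e he]
      · simp
    · exact ht
  · refine ⟨hN', by omega, hN', by omega, by omega, ?_⟩
    -- The zero vector is not upper, so diagonal pairs never get here; the vector in the second set
    -- is then nonzero and its negative is upper.
    have hne : c ≠ c' := by
      rintro rfl
      simp [IsUpper] at hu
    have hup := (isUpper_or_neg (hq c hc c' hc' hne)).resolve_left hu'
    rw [neg_sub, neg_sub] at hup
    have ht := h.table.push hc hc' hu hup (tv := 1) (.inr ⟨rfl, rfl, rfl⟩)
    constructor <;> try simp [h.n_eq, h.found, h.px_eq, h.py_eq, h.qx_eq, h.qy_eq, h.mat, h.cut]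
    · omega
    · intro e he
      rcases Nat.lt_or_eq_of_le he with he | rfl
      · rw [Function.update_of_ne he.ne, h.ord e he]
      · simp
    · exact ht
  · refine ⟨by omega, ?_⟩
    have ht := h.table.step_of_not_upper hc' hu
    constructor <;> try simp [h.n_eq, h.found, h.px_eq, h.py_eq, h.qx_eq, h.qy_eq, h.mat, h.cut]
    · omega
    · exact h.ord
    · exact ht

theorem pairProg_runs {n : ℕ} {px py qx qy : ℕ → ℝ} {W : ℕ} (hW : 8 * (n + 2) ^ 2 ≤ W)
    (hq : ∀ c < n, ∀ c' < n, c ≠ c' → ¬ (qx c' - qx c = 0 ∧ qy c' - qy c = 0)) {s : State}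
    (h : PairInv n px py qx qy 0 s) (h4 : s.iv 4 = 0) :
    Runs W pairProg s ((pairBody.bound + 20) * (n + 1) ^ 2) (PairInv n px py qx qy (n * n)) := by
  have hW1 : n * n + n + 2 < W := by nlinarith
  refine Runs.mono (Runs.loop (T := (pairBody.bound + 4) * n + 10)
    (fun c s => PairInv n px py qx qy (c * n) s ∧ s.iv 4 = c) n ?_ ?_ ⟨by simpa using h, h4⟩) ?_ ?_
  · rintro c s hc ⟨hs, hsc⟩
    refine ⟨by simp [hsc, hs.n_eq, hc], ?_⟩
    refine Runs.mono (Runs.seq (R := fun s => PairInv n px py qx qy (c * n + 0) s ∧ s.iv 4 = c ∧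
      s.iv 5 = 0) (Runs.of_wp ?_) fun s' hs' => Runs.seq (Runs.loop (T := pairBody.bound)
        (fun c' s => PairInv n px py qx qy (c * n + c') s ∧ s.iv 4 = c ∧ s.iv 5 = c') n ?_ ?_ hs')
        (T₂ := 4) (Q := fun s => PairInv n px py qx qy ((c + 1) * n) s ∧ s.iv 4 = c + 1)
        fun s' hs' => ?_) ?_ (fun _ => id)
    · simp only [wp, IExp.eval]
      refine ⟨by omega, ?_, by simp [hsc], by simp⟩
      obtain ⟨h1, h2, h3, h4, h5, h6, h7, h8, h9, h10, h11⟩ := hs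
      constructor <;> simpa
    · rintro c' s hc' ⟨hs, hs4, hs5⟩
      exact ⟨by simp [hs5, hs.n_eq, hc'], hs.body hW hq hc hc' hs4 hs5⟩
    · rintro s ⟨hs, hs4, hs5⟩
      simp [hs5, hs.n_eq]
    · obtain ⟨⟨h1, h2, h3, h4, h5, h6, h7, h8, h9, h10, h11⟩, hs4, hs5⟩ := hs'
      refine Runs.mono (Runs.of_wp (Q := fun s => PairInv n px py qx qy ((c + 1) * n) s ∧
        s.iv 4 = c + 1) ?_) (by simp [Prog.bound, IExp.cost]) (fun _ => id)
      simp only [wp, IExp.eval]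
      refine ⟨by nlinarith, ?_, by simp [hs4]⟩
      rw [Nat.succ_mul]
      constructor <;> simpa
    · simp only [Prog.bound, IExp.cost, BExp.cost]
      nlinarith
  · rintro s ⟨hs, hsc⟩
    simp [hsc, hs.n_eq]
  · simp only [BExp.cost, IExp.cost]
    nlinarith [Nat.zero_le pairBody.bound, Nat.zero_le (pairBody.bound * n)]
  · exact fun s hs => hs.1

end RealRAM
/-! ## Merging -/

/-- The consecutive blocks of length `w` of the list `A` of length `N` are sorted by `κ`. -/
def SortedBlocks {α : Type*} [LE α] (κ : ℕ → α) (N w : ℕ) (A : ℕ → ℕ) : Prop :=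
  ∀ c x y, c * w ≤ x → x ≤ y → y < (c + 1) * w → y < N → κ (A x) ≤ κ (A y)

/-- Intermediate situation when blocks of length `w` of `A` are merged into `B`: the blocks before
`lo` are done, `k` elements have been written, and the next candidates are at `i` and `j`. -/
structure MergeInv {α : Type*} [LE α] (κ : ℕ → α) (N w : ℕ) (A B : ℕ → ℕ) (lo i j k : ℕ) :
    Prop where
  aligned : ∃ c, lo = c * (2 * w)
  lo_le : lo ≤ i
  i_le : i ≤ lo + w
  le_j : lo + w ≤ j
  j_le : j ≤ lo + 2 * w
  sum_eq : k + (lo + w) = i + j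
  k_le : k ≤ N
  i_le' : i ≤ N
  j_le' : j = lo + w ∨ j ≤ N
  sorted : ∀ c x y, c * (2 * w) ≤ x → x ≤ y → y < (c + 1) * (2 * w) → y < k → κ (B x) ≤ κ (B y)
  left : ∀ x y, lo ≤ x → x < k → i ≤ y → y < lo + w → y < N → κ (B x) ≤ κ (A y)
  right : ∀ x y, lo ≤ x → x < k → j ≤ y → y < lo + 2 * w → y < N → κ (B x) ≤ κ (A y)
  cover : ∀ x < N, x < i ∨ (lo + w ≤ x ∧ x < j) → ∃ y < k, B y = A x
  range : ∀ y < k, B y < N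

namespace MergeInv

variable {α : Type*} [LinearOrder α] {κ : ℕ → α} {N w : ℕ} {A B : ℕ → ℕ} {lo i j k : ℕ}

theorem start (κ : ℕ → α) (N w : ℕ) (A B : ℕ → ℕ) : MergeInv κ N w A B 0 0 w 0 := by
  constructor <;> (try exact ⟨0, by simp⟩) <;> intros <;> omega

/-- By `sum_eq` a finished pair of blocks has `i = lo + w` and `j = lo + 2 * w`, so everything
before the new `lo` has been written. -/
theorem next (h : MergeInv κ N w A B lo i j k) (hk : ¬ k < lo + 2 * w) (hN : k < N) :
    MergeInv κ N w A B (lo + 2 * w) (lo + 2 * w) (lo + 2 * w + w) k := by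
  obtain ⟨⟨c, hc⟩, h1, h2, h3, h4, h5, h6, h7, h8, h9, h10, h11, h12, h13⟩ := h
  constructor
  case aligned => exact ⟨c + 1, by rw [hc]; ring⟩
  case sorted => exact h9
  case range => exact h13
  case cover =>
    intro x hx hx'
    exact h12 x hx (by omega)
  all_goals intros
  all_goals omega

/-- A block of length `2 * w` that contains position `k` starts at `lo` or later, so the new value
is compared only with what was written since `lo`. -/
theorem push (h : MergeInv κ N w A B lo i j k) (hk : k < lo + 2 * w) {v : ℕ}
    (hv : ∀ x, lo ≤ x → x < k → κ (B x) ≤ κ v) :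
    ∀ c x y, c * (2 * w) ≤ x → x ≤ y → y < (c + 1) * (2 * w) → y < k + 1 →
      κ (Function.update B k v x) ≤ κ (Function.update B k v y) := by
  intro c x y h1 h2 h3 h4
  rcases Nat.lt_succ_iff_lt_or_eq.1 h4 with h4 | rfl
  · rw [Function.update_of_ne (by omega), Function.update_of_ne (by omega)]
    exact h.sorted c x y h1 h2 h3 h4
  · rw [Function.update_self]
    rcases h2.lt_or_eq with h2 | rfl
    · rw [Function.update_of_ne h2.ne]
      refine hv x ?_ h2
      obtain ⟨c₀, hc₀⟩ := h.aligned
      have hlo := h.lo_le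
      have := h.sum_eq
      have := h.le_j
      have hle : c₀ ≤ c := by
        by_contra hlt
        have := Nat.mul_le_mul_right (2 * w) (show c + 1 ≤ c₀ by omega)
        omega
      have := Nat.mul_le_mul_right (2 * w) hle
      omega
    · rw [Function.update_self]

theorem block_left (h : MergeInv κ N w A B lo i j k) (hA : SortedBlocks κ N w A) {x y : ℕ}
    (h1 : lo ≤ x) (h2 : x ≤ y) (h3 : y < lo + w) (h4 : y < N) : κ (A x) ≤ κ (A y) := by
  obtain ⟨c, rfl⟩ := h.aligned
  -- The block number `c` of length `2 * w` consists of the blocks `2 * c` and `2 * c + 1` of length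
  -- `w`.
  have e1 : 2 * c * w = c * (2 * w) := by ring
  exact hA (2 * c) x y (by omega) h2 (by rw [Nat.succ_mul]; omega) h4

theorem block_right (h : MergeInv κ N w A B lo i j k) (hA : SortedBlocks κ N w A) {x y : ℕ}
    (h1 : lo + w ≤ x) (h2 : x ≤ y) (h3 : y < lo + 2 * w) (h4 : y < N) : κ (A x) ≤ κ (A y) := by
  obtain ⟨c, rfl⟩ := h.aligned
  have e1 : 2 * c * w = c * (2 * w) := by ring
  exact hA (2 * c + 1) x y (by rw [Nat.succ_mul]; omega) h2
    (by rw [Nat.succ_mul, Nat.succ_mul]; omega) h4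

/-- The element taken is at most everything unread: in its own block by sortedness, in the other one
through the candidate there. `takeRight` is the mirror image. -/
theorem takeLeft (h : MergeInv κ N w A B lo i j k) (hA : SortedBlocks κ N w A)
    (hr : ∀ x < N, A x < N) (hk : k < lo + 2 * w) (hN : k < N) (hi : i < lo + w) (hi' : i < N)
    (hc : j < lo + 2 * w → j < N → κ (A i) ≤ κ (A j)) :
    MergeInv κ N w A (Function.update B k (A i)) lo (i + 1) j (k + 1) := by
  have hs := h.push hk (v := A i) fun x h1 h2 => h.left x i h1 h2 le_rfl hi hi'
  have hbl := @h.block_left _ _ _ _ _ _ _ _ _ _ _ hA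
  have hbr := @h.block_right _ _ _ _ _ _ _ _ _ _ _ hA
  obtain ⟨h0, h1, h2, h3, h4, h5, h6, h7, h8, h9, h10, h11, h12, h13⟩ := h
  constructor
  case aligned => exact h0
  case sorted => exact hs
  case left =>
    intro x y hx hxk hy hyw hyN
    rcases Nat.lt_succ_iff_lt_or_eq.1 hxk with hxk | rfl
    · rw [Function.update_of_ne hxk.ne]
      exact h10 x y hx hxk (by omega) hyw hyN
    · rw [Function.update_self]
      exact hbl h1 (by omega) hyw hyN
  case right =>
    intro x y hx hxk hy hyw hyN
    rcases Nat.lt_succ_iff_lt_or_eq.1 hxk with hxk | rfl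
    · rw [Function.update_of_ne hxk.ne]
      exact h11 x y hx hxk (by omega) hyw hyN
    · rw [Function.update_self]
      exact (hc (by omega) (by omega)).trans (hbr h3 hy hyw hyN)
  case cover =>
    intro x hx hx'
    by_cases hxi : x = i
    · exact ⟨k, by omega, by simp [hxi]⟩
    · obtain ⟨y, hy, hy'⟩ := h12 x hx (by omega)
      exact ⟨y, by omega, by rw [Function.update_of_ne hy.ne, hy']⟩
  case range =>
    intro y hy
    rcases Nat.lt_succ_iff_lt_or_eq.1 hy with hy | rfl
    · rw [Function.update_of_ne hy.ne]
      exact h13 y hy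
    · rw [Function.update_self]
      exact hr i hi'
  all_goals omega

theorem takeRight (h : MergeInv κ N w A B lo i j k) (hA : SortedBlocks κ N w A)
    (hr : ∀ x < N, A x < N) (hk : k < lo + 2 * w) (hN : k < N)
    (hc : i < lo + w → i < N → j < lo + 2 * w ∧ j < N ∧ κ (A j) ≤ κ (A i)) :
    MergeInv κ N w A (Function.update B k (A j)) lo i (j + 1) (k + 1) := by
  -- If the left block is used up, `sum_eq` and the bounds on `k` leave an unread element in the
  -- right block.
  have hj : j < lo + 2 * w ∧ j < N := by
    by_cases hi : i < lo + w ∧ i < N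
    · exact ⟨(hc hi.1 hi.2).1, (hc hi.1 hi.2).2.1⟩
    · have := h.sum_eq
      have := h.i_le
      have := h.le_j
      omega
  have hs := h.push hk (v := A j) fun x h1 h2 => h.right x j h1 h2 le_rfl hj.1 hj.2
  have hbl := @h.block_left _ _ _ _ _ _ _ _ _ _ _ hA
  have hbr := @h.block_right _ _ _ _ _ _ _ _ _ _ _ hA
  obtain ⟨h0, h1, h2, h3, h4, h5, h6, h7, h8, h9, h10, h11, h12, h13⟩ := h
  constructor
  case aligned => exact h0
  case sorted => exact hs
  case left =>
    intro x y hx hxk hy hyw hyN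
    rcases Nat.lt_succ_iff_lt_or_eq.1 hxk with hxk | rfl
    · rw [Function.update_of_ne hxk.ne]
      exact h10 x y hx hxk (by omega) hyw hyN
    · rw [Function.update_self]
      exact (hc (by omega) (by omega)).2.2.trans (hbl h1 hy hyw hyN)
  case right =>
    intro x y hx hxk hy hyw hyN
    rcases Nat.lt_succ_iff_lt_or_eq.1 hxk with hxk | rfl
    · rw [Function.update_of_ne hxk.ne]
      exact h11 x y hx hxk (by omega) hyw hyN
    · rw [Function.update_self]
      exact hbr h3 (by omega) hyw hyN
  case cover =>
    intro x hx hx'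
    by_cases hxi : x = j
    · exact ⟨k, by omega, by simp [hxi]⟩
    · obtain ⟨y, hy, hy'⟩ := h12 x hx (by omega)
      exact ⟨y, by omega, by rw [Function.update_of_ne hy.ne, hy']⟩
  case range =>
    intro y hy
    rcases Nat.lt_succ_iff_lt_or_eq.1 hy with hy | rfl
    · rw [Function.update_of_ne hy.ne]
      exact h13 y hy
    · rw [Function.update_self]
      exact hr j hj.2
  all_goals omega

theorem sortedBlocks (h : MergeInv κ N w A B lo i j N) : SortedBlocks κ N (2 * w) B :=
  h.sorted

/-- At the end either `j = lo + w` and `i = N`, where the right block may lie beyond the list, or `i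
= lo + w` and `j = N`. In both cases everything has been read. -/
theorem exists_eq (h : MergeInv κ N w A B lo i j N) {x : ℕ} (hx : x < N) : ∃ y < N, B y = A x := by
  have := h.sum_eq
  have := h.j_le'
  have := h.i_le'
  have := h.i_le
  have := h.j_le
  have := h.lo_le
  have := h.le_j
  exact h.cover x hx (by omega)

end MergeInv

/-! ### Bottom-up merge sort as a program -/

namespace RealRAM

/-- Test whether the first of two entries of a table of vectors has the smaller angle. -/
def angleTest (x y : ℕ) (e f : IExp) : BExp :=
  .rlt (.const 0) (.sub (.mul (.get x e) (.get y f)) (.mul (.get y e) (.get x f)))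

/-- One step of merging. The integer variables `4` to `9` hold the number of elements written, the
two reading positions, the starting point of the second block, its end, and the length of blocks. -/
def mergeBody : Prog :=
  .ite (.ilt (.var 4) (.var 8)) .skip
    (.setI 5 (.var 8) ;;
      .setI 7 (.add (.var 8) (.var 9)) ;;
      .setI 6 (.var 7) ;;
      .setI 8 (.add (.var 7) (.var 9))) ;;
  .ite (.and (.ilt (.var 5) (.var 7)) (.and (.ilt (.var 5) (.var 2))
      (.not (.and (.ilt (.var 6) (.var 8)) (.and (.ilt (.var 6) (.var 2))
        (angleTest 4 5 (.get 4 (.var 6)) (.get 4 (.var 5))))))))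
    (.putI 5 (.var 4) (.get 4 (.var 5)) ;; .setI 5 (.add (.var 5) (.const 1)))
    (.putI 5 (.var 4) (.get 4 (.var 6)) ;; .setI 6 (.add (.var 6) (.const 1))) ;;
  .setI 4 (.add (.var 4) (.const 1))

/-- One step of copying the array `5` to the array `4`. -/
def copyBody : Prog :=
  .putI 4 (.var 4) (.get 5 (.var 4)) ;; .setI 4 (.add (.var 4) (.const 1))

/-- One pass of merge sort. -/
def passProg : Prog :=
  (.setI 4 (.const 0) ;;
    .setI 5 (.const 0) ;;
    .setI 7 (.var 9) ;;
    .setI 6 (.var 9) ;;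
    .setI 8 (.add (.var 9) (.var 9))) ;;
  .loop (.ilt (.var 4) (.var 2)) mergeBody ;;
  .setI 4 (.const 0) ;;
  .loop (.ilt (.var 4) (.var 2)) copyBody ;;
  .setI 9 (.add (.var 9) (.var 9))

/-- Merge sort of the list of pairs in the array `4`. -/
def sortProg : Prog :=
  .setI 9 (.const 1) ;; .loop (.ilt (.var 9) (.var 2)) passProg

/-- The two states agree except for the integer variables from `4` on and the integer arrays
in `V`. -/
def Agree (V : Set ℕ) (s₀ s : State) : Prop :=
  (∀ x < 4, s.iv x = s₀.iv x) ∧ s.ra = s₀.ra ∧ ∀ a ∉ V, s.ia a = s₀.ia a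

theorem Agree.refl (V : Set ℕ) (s : State) : Agree V s s := ⟨fun _ _ => rfl, rfl, fun _ _ => rfl⟩

theorem Agree.trans {V : Set ℕ} {s₁ s₂ s₃ : State} (h : Agree V s₁ s₂) (h' : Agree V s₂ s₃) :
    Agree V s₁ s₃ :=
  ⟨fun x hx => (h'.1 x hx).trans (h.1 x hx), h'.2.1.trans h.2.1,
    fun a ha => (h'.2.2 a ha).trans (h.2.2 a ha)⟩

theorem Agree.setI {V : Set ℕ} {s₀ s : State} (h : Agree V s₀ s) {x : ℕ} (hx : 4 ≤ x) (v : ℕ) :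
    Agree V s₀ (s.setI x v) :=
  ⟨fun y hy => by rw [State.setI_iv, if_neg (by omega), h.1 y hy], h.2.1, h.2.2⟩

theorem Agree.putI {V : Set ℕ} {s₀ s : State} (h : Agree V s₀ s) {a : ℕ} (ha : a ∈ V) (k v : ℕ) :
    Agree V s₀ (s.putI a k v) :=
  ⟨h.1, h.2.1, fun b hb => by
    rw [State.putI_ia, if_neg (by rintro rfl; exact hb ha), h.2.2 b hb]⟩

section
variable {α : Type*} [LinearOrder α] {κ : ℕ → α} {N W : ℕ}

/-- Comparison of entries below `N` in the arrays `x`, `y` is comparison of the values of `κ`. -/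
def IsKey (x y : ℕ) (κ : ℕ → α) (N : ℕ) (s : State) : Prop :=
  ∀ e < N, ∀ f < N, 0 < s.ra x e * s.ra y f - s.ra y e * s.ra x f ↔ κ e < κ f

theorem IsKey.congr {x y : ℕ} {s s' : State} (h : IsKey x y κ N s) (hs : s'.ra = s.ra) :
    IsKey x y κ N s' := by
  unfold IsKey
  rw [hs]
  exact h

/-- The state during the merging of the blocks of `A`. -/
structure MergeState (s₀ : State) (κ : ℕ → α) (N w : ℕ) (A : ℕ → ℕ) (lo k : ℕ) (s : State) :
    Prop where
  agree : Agree {4, 5} s₀ s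
  array : s.ia 4 = A
  k_eq : s.iv 4 = k
  mid_eq : s.iv 7 = lo + w
  hi_eq : s.iv 8 = lo + 2 * w
  w_eq : s.iv 9 = w
  inv : MergeInv κ N w A (s.ia 5) lo (s.iv 5) (s.iv 6) k

theorem mergeBody_runs (hW : 8 * (N + 1) ≤ W) {s₀ : State} (hN : s₀.iv 2 = N)
    (hκ : IsKey 4 5 κ N s₀) {w : ℕ} (hw0 : 0 < w) (hw : w < N) {A : ℕ → ℕ} (hA : SortedBlocks κ N w A)
    (hr : ∀ x < N, A x < N) {k lo : ℕ} {s : State} (hk : k < N)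
    (h : MergeState s₀ κ N w A lo k s) :
    Runs W mergeBody s mergeBody.bound fun s' => ∃ lo, MergeState s₀ κ N w A lo (k + 1) s' := by
  apply Runs.of_wp
  -- This treats the part of the body after the possible change of blocks, when the current blocks
  -- still have an element to write.
  have key : ∀ lo s, MergeState s₀ κ N w A lo k s → k < lo + 2 * w →
      wp W (.ite (.and (.ilt (.var 5) (.var 7)) (.and (.ilt (.var 5) (.var 2))
      (.not (.and (.ilt (.var 6) (.var 8)) (.and (.ilt (.var 6) (.var 2))
        (angleTest 4 5 (.get 4 (.var 6)) (.get 4 (.var 5))))))))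
    (.putI 5 (.var 4) (.get 4 (.var 5)) ;; .setI 5 (.add (.var 5) (.const 1)))
    (.putI 5 (.var 4) (.get 4 (.var 6)) ;; .setI 6 (.add (.var 6) (.const 1))) ;;
    .setI 4 (.add (.var 4) (.const 1)))
      (fun s' => ∃ lo, MergeState s₀ κ N w A lo (k + 1) s') s := by
    intro lo s h hlo
    obtain ⟨hag, h4, hk4, hmid, hhi, hw9, hinv⟩ := h
    have h2 : s.iv 2 = N := (hag.1 2 (by norm_num)).trans hN
    have hkey := hκ.congr hag.2.1
    simp only [wp, BExp.holds, IExp.eval, angleTest, RExp.eval, h4, hk4, hmid, hhi, h2,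
      State.setI_iv, State.putI_iv, Int.cast_zero]
    norm_num only [if_true, if_false]
    refine ⟨fun hb => ?_, fun hb => ?_⟩
    · obtain ⟨hb1, hb2, hb3⟩ := hb
      have hrr := hr _ hb2
      refine ⟨by omega, by omega, by omega, by omega, lo, ?_⟩
      refine ⟨((hag.putI (by simp) _ _).setI (by norm_num) _).setI (by norm_num) _,
        ?_, ?_, ?_, ?_, ?_, ?_⟩ <;> simp [h4, hmid, hhi, hw9]
      refine hinv.takeLeft hA hr hlo hk hb1 hb2 fun hj hj' => ?_
      by_contra hlt
      exact hb3 ⟨hj, hj', (hkey _ (hr _ hj') _ hrr).2 (not_le.1 hlt)⟩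
    · have hj : s.iv 6 < N := by
        by_contra hj
        apply hb
        have := hinv.sum_eq
        have := hinv.i_le
        have := hinv.le_j
        have := hinv.j_le
        have := hinv.j_le'
        refine ⟨by omega, by omega, fun h => by omega⟩
      have hrr := hr _ hj
      refine ⟨by omega, by omega, by omega, by omega, lo, ?_⟩
      refine ⟨((hag.putI (by simp) _ _).setI (by norm_num) _).setI (by norm_num) _,
        ?_, ?_, ?_, ?_, ?_, ?_⟩ <;> simp [h4, hmid, hhi, hw9]
      refine hinv.takeRight hA hr hlo hk fun hi hi' => ?_
      have := not_not.1 fun hn => hb ⟨hi, hi', hn⟩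
      exact ⟨this.1, this.2.1, ((hkey _ hrr _ (hr _ hi')).1 this.2.2).le⟩
  unfold mergeBody
  rw [wp]
  obtain ⟨hag, h4, hk4, hmid, hhi, hw9, hinv⟩ := h
  refine ⟨fun hb => key lo s ⟨hag, h4, hk4, hmid, hhi, hw9, hinv⟩ ?_, fun hb => ?_⟩
  · simpa [hk4, hhi] using hb
  · simp [hk4, hhi] at hb
    have hle : lo + 2 * w ≤ k := hb
    have := hinv.sum_eq
    have := hinv.i_le
    have := hinv.j_le
    simp only [wp, IExp.eval, State.setI_iv, hhi, hw9]
    norm_num only [if_true, if_false]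
    refine ⟨by omega, by omega, by omega, by omega, key (lo + 2 * w) _ ?_ (by omega)⟩
    refine ⟨(((hag.setI (by norm_num) _).setI (by norm_num) _).setI (by norm_num) _).setI
      (by norm_num) _, ?_, ?_, ?_, ?_, ?_, ?_⟩ <;> simp [h4, hk4, hw9]
    · ring
    · exact hinv.next (by omega) hk

theorem passProg_runs (hW : 8 * (N + 1) ≤ W) {s₀ : State} (hN : s₀.iv 2 = N)
    (hκ : IsKey 4 5 κ N s₀) {w : ℕ} (hw0 : 0 < w) (hw : w < N) (hA : SortedBlocks κ N w (s₀.ia 4))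
    (hr : ∀ x < N, s₀.ia 4 x < N) (h9 : s₀.iv 9 = w) :
    Runs W passProg s₀ ((mergeBody.bound + copyBody.bound + 60) * (N + 1)) fun s =>
      Agree {4, 5} s₀ s ∧ s.iv 9 = 2 * w ∧ SortedBlocks κ N (2 * w) (s.ia 4) ∧
        (∀ x < N, s.ia 4 x < N) ∧ ∀ x < N, ∃ y < N, s.ia 4 y = s₀.ia 4 x := by
  set A := s₀.ia 4 with hAdef
  refine Runs.mono (Runs.seq (R := fun s => ∃ lo, MergeState s₀ κ N w A lo 0 s)
    (Runs.of_wp ?_) fun s₁ hs₁ => Runs.seq (Runs.loop (T := mergeBody.bound)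
      (fun k s => ∃ lo, MergeState s₀ κ N w A lo k s) N ?_ ?_ hs₁) fun s₂ hs₂ => Runs.seq
      -- The state after merging is kept as a witness: `MergeState` fails as soon as copying
      -- overwrites array `4`, but its facts about the merged list are still needed.
      (R := fun s => ∃ s₂, (∃ lo, MergeState s₀ κ N w A lo N s₂) ∧ Agree {4, 5} s₀ s ∧
        s.iv 9 = w ∧ s.ia 5 = s₂.ia 5 ∧ s.iv 4 = 0 ∧ ∀ x < 0, s.ia 4 x = s₂.ia 5 x)
      (Runs.of_wp ?_) fun s₃ hs₃ => Runs.seq (Runs.loop (T := copyBody.bound)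
      (fun k s => ∃ s₂, (∃ lo, MergeState s₀ κ N w A lo N s₂) ∧ Agree {4, 5} s₀ s ∧
        s.iv 9 = w ∧ s.ia 5 = s₂.ia 5 ∧ s.iv 4 = k ∧ ∀ x < k, s.ia 4 x = s₂.ia 5 x) N ?_ ?_ hs₃)
      fun s₄ hs₄ => Runs.of_wp ?_) ?_ (fun _ => id)
  · simp only [wp, IExp.eval, State.setI_iv, h9]
    norm_num only [if_true, if_false]
    refine ⟨by omega, by omega, by omega, by omega, by omega, 0, ?_⟩
    refine ⟨((((((Agree.refl _ _).setI (by norm_num) _).setI (by norm_num) _).setI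
      (by norm_num) _).setI (by norm_num) _).setI (by norm_num) _), ?_, ?_, ?_, ?_, ?_, ?_⟩ <;>
      simp [h9, hAdef]
    · ring
    · exact MergeInv.start ..
  · rintro k s hk ⟨lo, hs⟩
    refine ⟨?_, mergeBody_runs hW hN hκ hw0 hw hA hr hk hs⟩
    simp [hs.k_eq, hs.agree.1, hN, hk]
  · rintro s ⟨lo, hs⟩
    simp [hs.k_eq, hs.agree.1, hN]
  · simp only [wp, IExp.eval]
    refine ⟨by omega, s₂, hs₂, ?_⟩
    obtain ⟨lo, hs⟩ := hs₂
    exact ⟨hs.agree.setI (by norm_num) _, by simp [hs.w_eq], by simp, by simp, by simp⟩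
  · rintro k s hk ⟨s₂, ⟨lo, hs₂⟩, hag, hs9, hs5, hs4, hx⟩
    refine ⟨by simp [hs4, hag.1, hN, hk], Runs.of_wp ?_⟩
    have hlt := hs₂.inv.range k hk
    simp only [wp, copyBody, IExp.eval, hs4, hs5, State.putI_iv]
    refine ⟨by omega, by omega, by omega, s₂, ⟨lo, hs₂⟩,
      (hag.putI (by simp) _ _).setI (by norm_num) _, by simp [hs9], by simp [hs5], by simp, ?_⟩
    intro x hxk
    rcases Nat.lt_succ_iff_lt_or_eq.1 hxk with hxk | rfl
    · simp [Function.update_of_ne hxk.ne, hx x hxk]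
    · simp
  · rintro s ⟨s₂, -, hag, -, -, hs4, -⟩
    simp [hs4, hag.1, hN]
  · obtain ⟨s₂, ⟨lo, hs₂⟩, hag, hs9, hs5, hs4, hx⟩ := hs₄
    simp only [wp, IExp.eval, hs9]
    refine ⟨by omega, hag.setI (by norm_num) _, by simp; ring, ?_, ?_, ?_⟩
    · intro c x y h1 h2 h3 h4
      simp only [State.setI_ia]
      rw [hx x (by omega), hx y h4]
      exact hs₂.inv.sortedBlocks c x y h1 h2 h3 h4
    · intro x hxN
      simp only [State.setI_ia]
      rw [hx x hxN]
      exact hs₂.inv.range x hxN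
    · intro x hxN
      obtain ⟨y, hy, hy'⟩ := hs₂.inv.exists_eq hxN
      exact ⟨y, hy, by simp only [State.setI_ia]; rw [hx y hy, hy']⟩
  · simp only [Prog.bound, IExp.cost, BExp.cost]
    nlinarith

/-- After `p` passes the blocks of length `2 ^ p` are sorted, and `2 ^ Nat.clog 2 N ≥ N` makes the
whole list one block. -/
theorem sortProg_runs (hW : 8 * (N + 1) ≤ W) {s₀ : State} (hN : s₀.iv 2 = N)
    (hκ : IsKey 4 5 κ N s₀) (hord : ∀ e < N, s₀.ia 4 e = e) :
    Runs W sortProg s₀ ((mergeBody.bound + copyBody.bound + 70) * (N + 1) * (Nat.clog 2 N + 1))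
      fun s => Agree {4, 5} s₀ s ∧ (∀ i j, i ≤ j → j < N → κ (s.ia 4 i) ≤ κ (s.ia 4 j)) ∧
        (∀ x < N, s.ia 4 x < N) ∧ ∀ x < N, ∃ y < N, s.ia 4 y = x := by
  refine Runs.mono (Runs.seq (R := fun s => Agree {4, 5} s₀ s ∧ s.iv 9 = 2 ^ 0 ∧
      SortedBlocks κ N (2 ^ 0) (s.ia 4) ∧ (∀ x < N, s.ia 4 x < N) ∧
        ∀ x < N, ∃ y < N, s.ia 4 y = x) (Runs.of_wp ?_) fun s₁ hs₁ => Runs.loop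
      (T := (mergeBody.bound + copyBody.bound + 60) * (N + 1))
      (fun p s => Agree {4, 5} s₀ s ∧ s.iv 9 = 2 ^ p ∧ SortedBlocks κ N (2 ^ p) (s.ia 4) ∧
        (∀ x < N, s.ia 4 x < N) ∧ ∀ x < N, ∃ y < N, s.ia 4 y = x) (Nat.clog 2 N) ?_ ?_ hs₁) ?_ ?_
  · simp only [wp, IExp.eval]
    refine ⟨by omega, (Agree.refl _ _).setI (by norm_num) _, by simp, ?_, ?_, ?_⟩
    · intro c x y h1 h2 h3 h4
      have : x = y := by omega
      rw [this]
    · intro x hx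
      simpa [hord x hx] using hx
    · intro x hx
      exact ⟨x, hx, hord x hx⟩
  · rintro p s hp ⟨hag, h9, hsb, hr, hs⟩
    have hlt : 2 ^ p < N := (Nat.lt_clog_iff_pow_lt (by norm_num)).1 hp
    have hN' : s.iv 2 = N := (hag.1 2 (by norm_num)).trans hN
    refine ⟨by simp [h9, hN', hlt], ?_⟩
    refine Runs.mono (passProg_runs hW hN' (hκ.congr hag.2.1) (by positivity) hlt hsb hr h9)
      le_rfl ?_
    rintro s' ⟨hag', h9', hsb', hr', hs'⟩
    refine ⟨hag.trans hag', by rw [h9']; ring, by rwa [pow_succ'], hr', fun x hx => ?_⟩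
    obtain ⟨y, hy, rfl⟩ := hs x hx
    exact hs' y hy
  · rintro s ⟨hag, h9, -⟩
    have hN' : s.iv 2 = N := (hag.1 2 (by norm_num)).trans hN
    simp [h9, hN', Nat.le_pow_clog]
  · simp only [Prog.bound, IExp.cost, BExp.cost]
    nlinarith [Nat.zero_le (N * Nat.clog 2 N)]
  · rintro s ⟨hag, h9, hsb, hr, hs⟩
    refine ⟨hag, fun i j hij hj => hsb 0 i j (by omega) hij ?_ hj, hr, hs⟩
    have := Nat.le_pow_clog (b := 2) (by norm_num) N
    omega
end
end RealRAM
/-! ## Extreme elements -/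

/-- `m` is an element of `S` with the least value of `κ`, or `m = N` and `S` is empty. -/
def IsBest {α : Type*} [LE α] (κ : ℕ → α) (N : ℕ) (S : ℕ → Prop) (m : ℕ) : Prop :=
  (m = N ∧ ∀ x, ¬ S x) ∨ (m < N ∧ S m ∧ ∀ x, S x → κ m ≤ κ x)

section
variable {α : Type*} [LinearOrder α] {κ : ℕ → α} {N m : ℕ} {S S' : ℕ → Prop}

theorem IsBest.congr (h : IsBest κ N S m) (hS : ∀ x, S' x ↔ S x) : IsBest κ N S' m := by
  obtain rfl : S' = S := funext fun x => propext (hS x)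
  exact h

theorem IsBest.le (h : IsBest κ N S m) : m ≤ N := by
  rcases h with h | h
  · exact h.1.le
  · exact h.1.le

theorem IsBest.keep (h : IsBest κ N S m) {e : ℕ} (hS : ∀ x, S' x ↔ S x ∨ x = e) (hm : m < N)
    (hlt : κ m < κ e) : IsBest κ N S' m := by
  rcases h with h | h
  · exact absurd h.1 hm.ne
  · refine .inr ⟨hm, (hS m).2 (.inl h.2.1), fun x hx => ?_⟩
    rcases (hS x).1 hx with hx | rfl
    · exact h.2.2 x hx
    · exact hlt.le

theorem IsBest.replace (h : IsBest κ N S m) {e : ℕ} (hS : ∀ x, S' x ↔ S x ∨ x = e) (he : e < N)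
    (hlt : m < N → κ e ≤ κ m) : IsBest κ N S' e := by
  refine .inr ⟨he, (hS e).2 (.inr rfl), fun x hx => ?_⟩
  rcases (hS x).1 hx with hx | rfl
  · rcases h with h | h
    · exact absurd hx (h.2 x)
    · exact (hlt h.1).trans (h.2.2 x hx)
  · exact le_rfl

/-- The greatest element of `S`, least in the dual order, and the least element of `S'` decide. The
index `N` signals an empty set, for which nothing is to be shown. -/
theorem IsBest.forall_lt_iff {m' : ℕ} (h : IsBest (OrderDual.toDual ∘ κ) N S m)
    (h' : IsBest κ N S' m') :
    (∀ x y, S x → S' y → κ x < κ y) ↔ (m < N → m' < N → κ m < κ m') := by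
  constructor
  · intro hall hm hm'
    exact hall _ _ (h.resolve_left fun h => hm.ne h.1).2.1
      (h'.resolve_left fun h => hm'.ne h.1).2.1
  · intro hlt x y hx hy
    have h1 := h.resolve_left fun h => h.2 x hx
    have h2 := h'.resolve_left fun h => h.2 y hy
    exact (show κ x ≤ κ m from h1.2.2 x hx).trans_lt ((hlt h1.1 h2.1).trans_le (h2.2.2 y hy))
end

/-! ### Scans for the extremes of prefixes and suffixes -/

namespace RealRAM

/-- Test for equality with a constant. -/
def eqTest (e : IExp) (c : ℕ) : BExp := .and (.not (.ilt e (.const c))) (.not (.ilt (.const c) e))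

@[simp] theorem eqTest_holds {s : State} {e : IExp} {c : ℕ} :
    (eqTest e c).holds s ↔ e.eval s = c := by
  simp only [eqTest, BExp.holds, IExp.eval]
  omega

/-- One step of a scan: the integer variables `4`, `5`, `6` hold the number of entries scanned,
the current entry and the best one so far. -/
def scanBody (o : ℕ) (pos : IExp) (τ : ℕ) (cmp : BExp) : Prog :=
  .setI 5 (.get 4 pos) ;;
  .setI 6 (.get o (.var 4)) ;;
  .ite (.and (eqTest (.get 3 (.var 5)) τ) (.not (.and (.ilt (.var 6) (.var 2)) cmp)))
    (.putI o (.add (.var 4) (.const 1)) (.var 5))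
    (.putI o (.add (.var 4) (.const 1)) (.var 6)) ;;
  .setI 4 (.add (.var 4) (.const 1))

/-- Scan the list of pairs in the order given by `pos`, and keep for all numbers `k` the best one
among the first `k` pairs of type `τ` in the array `o`. -/
def scanProg (o : ℕ) (pos : IExp) (τ : ℕ) (cmp : BExp) : Prog :=
  (.putI o (.const 0) (.var 2) ;; .setI 4 (.const 0)) ;;
  .loop (.ilt (.var 4) (.var 2)) (scanBody o pos τ cmp)

theorem scanProg_runs {α : Type*} [LinearOrder α] {κ : ℕ → α} {N W : ℕ} (hW : 8 * (N + 1) ≤ W)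
    {s₀ : State} (hN : s₀.iv 2 = N) {o τ : ℕ} (ho : 10 ≤ o) {pos : IExp} {p : ℕ → ℕ}
    (hpos : ∀ s : State, ∀ i < N, s.iv 2 = N → s.iv 4 = i → pos.eval s = p i)
    (hp : ∀ i < N, p i < N) {cmp : BExp}
    (hcmp : ∀ s, s.ra = s₀.ra → s.iv 5 < N → s.iv 6 < N →
      (cmp.holds s ↔ κ (s.iv 6) < κ (s.iv 5)))
    (hord : ∀ j < N, s₀.ia 4 j < N) :
    Runs W (scanProg o pos τ cmp) s₀ (((scanBody o pos τ cmp).bound + 20) * (N + 1)) fun s =>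
      Agree {o} s₀ s ∧ ∀ k ≤ N,
        IsBest κ N (fun x => ∃ i < k, s₀.ia 4 (p i) = x ∧ s₀.ia 3 x = τ) (s.ia o k) := by
  refine Runs.mono (Runs.seq (R := fun s => Agree {o} s₀ s ∧ s.iv 4 = 0 ∧ ∀ k ≤ 0,
      IsBest κ N (fun x => ∃ i < k, s₀.ia 4 (p i) = x ∧ s₀.ia 3 x = τ) (s.ia o k))
    (Runs.of_wp ?_) fun s₁ hs₁ => Runs.loop (T := (scanBody o pos τ cmp).bound)
      (fun i s => Agree {o} s₀ s ∧ s.iv 4 = i ∧ ∀ k ≤ i,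
        IsBest κ N (fun x => ∃ i < k, s₀.ia 4 (p i) = x ∧ s₀.ia 3 x = τ) (s.ia o k)) N ?_ ?_ hs₁)
    ?_ fun s hs => ⟨hs.1, hs.2.2⟩
  · simp only [wp, IExp.eval, hN]
    refine ⟨by omega, by omega, by omega,
      ((Agree.refl _ _).putI (by simp) _ _).setI (by norm_num) _, by simp, fun k hk => ?_⟩
    obtain rfl : k = 0 := by omega
    exact .inl ⟨by simp, by simp⟩
  · rintro i s hi ⟨hag, h4, hbest⟩
    have h2 : s.iv 2 = N := (hag.1 2 (by norm_num)).trans hN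
    refine ⟨by simp [h2, h4, hi], Runs.of_wp ?_⟩
    have hm := hbest i le_rfl
    have he := hord _ (hp i hi)
    have hia4 : s.ia 4 = s₀.ia 4 := hag.2.2 4 (by simp; omega)
    have hia3 : s.ia 3 = s₀.ia 3 := hag.2.2 3 (by simp; omega)
    -- The comparison takes place after the current entry and the best one so far have been loaded
    -- into the variables `5` and `6`.
    have hc := hcmp ((s.setI 5 (s₀.ia 4 (p i))).setI 6 (s.ia o i)) hag.2.1
    simp only [State.setI_iv] at hc
    norm_num only [if_true, if_false] at hc
    simp only [scanBody, wp, IExp.eval, BExp.holds, eqTest_holds, hpos s i hi h2 h4, hia4, hia3,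
      State.setI_ia, State.setI_iv, State.putI_iv, h4, h2]
    norm_num only [if_true, if_false]
    have hle := hm.le
    have hext : s₀.ia 3 (s₀.ia 4 (p i)) = τ → ∀ x,
        (∃ i' < i + 1, s₀.ia 4 (p i') = x ∧ s₀.ia 3 x = τ) ↔
        (∃ i' < i, s₀.ia 4 (p i') = x ∧ s₀.ia 3 x = τ) ∨ x = s₀.ia 4 (p i) := by
      intro ht x
      constructor
      · rintro ⟨i', hi', h⟩
        rcases Nat.lt_succ_iff_lt_or_eq.1 hi' with hi' | rfl
        · exact .inl ⟨i', hi', h⟩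
        · exact .inr h.1.symm
      · rintro (⟨i', hi', h⟩ | rfl)
        · exact ⟨i', by omega, h⟩
        · exact ⟨i, by omega, rfl, ht⟩
    have hfin : ∀ v, IsBest κ N (fun x => ∃ i' < i + 1, s₀.ia 4 (p i') = x ∧ s₀.ia 3 x = τ) v →
        ∀ k ≤ i + 1, IsBest κ N (fun x => ∃ i < k, s₀.ia 4 (p i) = x ∧ s₀.ia 3 x = τ)
          (Function.update (s.ia o) (i + 1) v k) := by
      intro v hv k hk
      rcases hk.lt_or_eq with hk | rfl
      · rw [Function.update_of_ne hk.ne]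
        exact hbest k (by omega)
      · simpa using hv
    refine ⟨by omega, by omega, fun hb => ?_, fun hb => ?_⟩
    · refine ⟨by omega, by omega, by omega,
        (((hag.setI (by norm_num) _).setI (by norm_num) _).putI (by simp) _ _).setI (by norm_num) _,
        by simp, ?_⟩
      simp only [State.setI_ia, State.putI_ia, if_true]
      refine hfin _ (hm.replace (hext hb.1) he fun hmN => ?_)
      by_contra hlt
      exact hb.2 ⟨hmN, (hc he hmN).2 (not_le.1 hlt)⟩
    · refine ⟨by omega, by omega, by omega,
        (((hag.setI (by norm_num) _).setI (by norm_num) _).putI (by simp) _ _).setI (by norm_num) _,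
        by simp, ?_⟩
      simp only [State.setI_ia, State.putI_ia, if_true]
      refine hfin _ ?_
      by_cases ht : s₀.ia 3 (s₀.ia 4 (p i)) = τ
      · have := not_not.1 fun hn => hb ⟨ht, hn⟩
        exact hm.keep (hext ht) this.1 ((hc he this.1).1 this.2)
      -- An entry of the other type leaves the set of candidates unchanged.
      · refine hm.congr fun x => ⟨?_, fun ⟨i', hi', h⟩ => ⟨i', by omega, h⟩⟩
        rintro ⟨i', hi', h⟩
        rcases Nat.lt_succ_iff_lt_or_eq.1 hi' with hi' | rfl
        · exact ⟨i', hi', h⟩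
        · exact absurd (h.1 ▸ h.2) ht
  · rintro s ⟨hag, h4, -⟩
    simp [h4, hag.1, hN]
  · simp only [Prog.bound, IExp.cost, BExp.cost]
    nlinarith

/-- Position counted from the start of the list. -/
def fwd : IExp := .var 4

/-- Position counted from the end of the list. -/
def bwd : IExp := .sub (.sub (.var 2) (.const 1)) (.var 4)

/-- The best entry so far is smaller than the current one. -/
def minTest : BExp := angleTest 6 7 (.var 6) (.var 5)

/-- The best entry so far is larger than the current one. -/
def maxTest : BExp := angleTest 6 7 (.var 5) (.var 6)

/-- The scans from both sides for maxima and minima of both types. -/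
def scansProg : Prog :=
  scanProg 10 fwd 0 maxTest ;; scanProg 11 fwd 1 maxTest ;;
  scanProg 12 fwd 0 minTest ;; scanProg 13 fwd 1 minTest ;;
  scanProg 14 bwd 0 maxTest ;; scanProg 15 bwd 1 maxTest ;;
  scanProg 16 bwd 0 minTest ;; scanProg 17 bwd 1 minTest

/-- The results of the scans. -/
structure ScanResult {α : Type*} [LinearOrder α] (κ : ℕ → α) (N : ℕ) (s : State) : Prop where
  preMax : ∀ τ < 2, ∀ k ≤ N, IsBest (OrderDual.toDual ∘ κ) N
    (fun x => ∃ j < k, s.ia 4 j = x ∧ s.ia 3 x = τ) (s.ia (10 + τ) k)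
  preMin : ∀ τ < 2, ∀ k ≤ N, IsBest κ N
    (fun x => ∃ j < k, s.ia 4 j = x ∧ s.ia 3 x = τ) (s.ia (12 + τ) k)
  sufMax : ∀ τ < 2, ∀ k ≤ N, IsBest (OrderDual.toDual ∘ κ) N
    (fun x => ∃ j < N, k ≤ j ∧ s.ia 4 j = x ∧ s.ia 3 x = τ) (s.ia (14 + τ) (N - k))
  sufMin : ∀ τ < 2, ∀ k ≤ N, IsBest κ N
    (fun x => ∃ j < N, k ≤ j ∧ s.ia 4 j = x ∧ s.ia 3 x = τ) (s.ia (16 + τ) (N - k))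

section
variable {α : Type*} [LinearOrder α] {κ : ℕ → α} {N W : ℕ}

theorem IsKey.minTest {s₀ : State} (h : IsKey 6 7 κ N s₀) (s : State) (hs : s.ra = s₀.ra)
    (h5 : s.iv 5 < N) (h6 : s.iv 6 < N) : minTest.holds s ↔ κ (s.iv 6) < κ (s.iv 5) := by
  have := h.congr hs _ h6 _ h5
  simpa [RealRAM.minTest, angleTest] using this

theorem IsKey.maxTest {s₀ : State} (h : IsKey 6 7 κ N s₀) (s : State) (hs : s.ra = s₀.ra)
    (h5 : s.iv 5 < N) (h6 : s.iv 6 < N) :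
    maxTest.holds s ↔ (OrderDual.toDual ∘ κ) (s.iv 6) < (OrderDual.toDual ∘ κ) (s.iv 5) := by
  have := h.congr hs _ h5 _ h6
  simpa [RealRAM.maxTest, angleTest] using this

theorem scansProg_runs (hW : 8 * (N + 1) ≤ W) {s₀ : State} (hN : s₀.iv 2 = N)
    (hκ : IsKey 6 7 κ N s₀) (hord : ∀ j < N, s₀.ia 4 j < N) :
    Runs W scansProg s₀ (8 * (((scanBody 10 bwd 0 maxTest).bound + 20) * (N + 1))) fun s =>
      Agree (Set.Icc 10 17) s₀ s ∧ ScanResult κ N s := by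
  have hfwd : ∀ s : State, ∀ i < N, s.iv 2 = N → s.iv 4 = i → fwd.eval s = i :=
    fun s i _ _ h => h
  have hbwd : ∀ s : State, ∀ i < N, s.iv 2 = N → s.iv 4 = i → bwd.eval s = N - 1 - i :=
    fun s i _ h2 h => by simp [bwd, h2, h]
  -- The suffix from position `k` on is the set of the first `N - k` entries read backwards; hence
  -- the index `N - k` in `ScanResult`.
  have hb : ∀ k ≤ N, ∀ τ (A t : ℕ → ℕ) x, (∃ j < N, k ≤ j ∧ A j = x ∧ t x = τ) ↔
      ∃ i < N - k, A (N - 1 - i) = x ∧ t x = τ := by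
    intro k hk τ A t x
    constructor
    · rintro ⟨j, hj, hkj, h⟩
      exact ⟨N - 1 - j, by omega, by rwa [show N - 1 - (N - 1 - j) = j by omega]⟩
    · rintro ⟨i, hi, h⟩
      exact ⟨N - 1 - i, by omega, by omega, h⟩
  -- One statement for all eight scans. Each writes to its own array only, so its result can be
  -- traced through the later ones.
  have step : ∀ {β : Type _} [LinearOrder β] (κ' : ℕ → β) (o τ : ℕ) (pos : IExp) (p : ℕ → ℕ)
      (cmp : BExp) (s : State), Agree (Set.Icc 10 17) s₀ s → o ∈ Set.Icc 10 17 →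
      (∀ s : State, ∀ i < N, s.iv 2 = N → s.iv 4 = i → pos.eval s = p i) →
      (∀ i < N, p i < N) →
      (∀ s', s'.ra = s.ra → s'.iv 5 < N → s'.iv 6 < N →
        (cmp.holds s' ↔ κ' (s'.iv 6) < κ' (s'.iv 5))) →
      (scanBody o pos τ cmp).bound ≤ (scanBody 10 bwd 0 RealRAM.maxTest).bound →
      Runs W (scanProg o pos τ cmp) s
        (((scanBody 10 bwd 0 RealRAM.maxTest).bound + 20) * (N + 1)) fun s' =>
        Agree (Set.Icc 10 17) s₀ s' ∧ (∀ o' ≠ o, s'.ia o' = s.ia o') ∧ ∀ k ≤ N,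
        IsBest κ' N (fun x => ∃ i < k, s₀.ia 4 (p i) = x ∧ s₀.ia 3 x = τ) (s'.ia o k) := by
    intro β _ κ' o τ pos p cmp s hag ho hpos hp hcmp hbd
    have h4 : s.ia 4 = s₀.ia 4 := hag.2.2 4 (by simp)
    have h3 : s.ia 3 = s₀.ia 3 := hag.2.2 3 (by simp)
    refine Runs.mono (scanProg_runs hW ((hag.1 2 (by norm_num)).trans hN) ho.1 hpos hp hcmp
      (by simpa [h4] using hord)) (by gcongr) ?_
    rintro s' ⟨hag', hs'⟩
    refine ⟨hag.trans ⟨hag'.1, hag'.2.1, fun a ha => hag'.2.2 a ?_⟩, fun o' ho' => hag'.2.2 o' ho',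
      by simpa only [h4, h3] using hs'⟩
    rintro rfl
    exact ha ho
  have hf : ∀ i < N, i < N := fun _ => id
  have hb' : ∀ i < N, N - 1 - i < N := fun i hi => by omega
  have hlast : ∀ {s : State}, Agree (Set.Icc 10 17) s₀ s → IsKey 6 7 κ N s :=
    fun h => hκ.congr h.2.1
  refine Runs.mono ((step (OrderDual.toDual ∘ κ) 10 0 fwd (fun i => i) _ s₀ (Agree.refl _ _)
    (by simp) hfwd hf (hlast (Agree.refl _ _)).maxTest (by decide)).seq fun s₁ h₁ =>
    (step (OrderDual.toDual ∘ κ) 11 1 fwd (fun i => i) _ s₁ h₁.1 (by simp) hfwd hf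
      (hlast h₁.1).maxTest (by decide)).seq fun s₂ h₂ =>
    (step κ 12 0 fwd (fun i => i) _ s₂ h₂.1 (by simp) hfwd hf
      (hlast h₂.1).minTest (by decide)).seq fun s₃ h₃ =>
    (step κ 13 1 fwd (fun i => i) _ s₃ h₃.1 (by simp) hfwd hf
      (hlast h₃.1).minTest (by decide)).seq fun s₄ h₄ =>
    (step (OrderDual.toDual ∘ κ) 14 0 bwd (fun i => N - 1 - i) _ s₄ h₄.1 (by simp) hbwd hb'
      (hlast h₄.1).maxTest (by decide)).seq fun s₅ h₅ =>
    (step (OrderDual.toDual ∘ κ) 15 1 bwd (fun i => N - 1 - i) _ s₅ h₅.1 (by simp) hbwd hb'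
      (hlast h₅.1).maxTest (by decide)).seq fun s₆ h₆ =>
    (step κ 16 0 bwd (fun i => N - 1 - i) _ s₆ h₆.1 (by simp) hbwd hb'
      (hlast h₆.1).minTest (by decide)).seq fun s₇ h₇ =>
    (step κ 17 1 bwd (fun i => N - 1 - i) _ s₇ h₇.1 (by simp) hbwd hb'
      (hlast h₇.1).minTest (by decide)).mono le_rfl
    (Q' := fun s => Agree (Set.Icc 10 17) s₀ s ∧ ScanResult κ N s) fun s₈ h₈ => ⟨h₈.1, ?_⟩)
    (by omega) (fun _ => id)
  have h4 : s₈.ia 4 = s₀.ia 4 := h₈.1.2.2 4 (by simp)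
  have h3 : s₈.ia 3 = s₀.ia 3 := h₈.1.2.2 3 (by simp)
  constructor <;> intro τ hτ k hk <;> rw [h4, h3] <;> interval_cases τ
  · rw [h₈.2.1, h₇.2.1, h₆.2.1, h₅.2.1, h₄.2.1, h₃.2.1, h₂.2.1] <;> try norm_num
    exact h₁.2.2 k hk
  · rw [h₈.2.1, h₇.2.1, h₆.2.1, h₅.2.1, h₄.2.1, h₃.2.1] <;> try norm_num
    exact h₂.2.2 k hk
  · rw [h₈.2.1, h₇.2.1, h₆.2.1, h₅.2.1, h₄.2.1] <;> try norm_num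
    exact h₃.2.2 k hk
  · rw [h₈.2.1, h₇.2.1, h₆.2.1, h₅.2.1] <;> try norm_num
    exact h₄.2.2 k hk
  · rw [h₈.2.1, h₇.2.1, h₆.2.1] <;> try norm_num
    exact (h₅.2.2 (N - k) (by omega)).congr fun x => hb k hk 0 (s₀.ia 4) (s₀.ia 3) x
  · rw [h₈.2.1, h₇.2.1] <;> try norm_num
    exact (h₆.2.2 (N - k) (by omega)).congr fun x => hb k hk 1 (s₀.ia 4) (s₀.ia 3) x
  · rw [h₈.2.1] <;> try norm_num
    exact (h₇.2.2 (N - k) (by omega)).congr fun x => hb k hk 0 (s₀.ia 4) (s₀.ia 3) x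
  · exact (h₈.2.2 (N - k) (by omega)).congr fun x => hb k hk 1 (s₀.ia 4) (s₀.ia 3) x
end
end RealRAM
-- Search for a cut that suits both sets
namespace RealRAM

/-- The greatest of some pairs is smaller than the least of others, unless there are none. -/
def belowTest (e f : IExp) : BExp :=
  .not (.and (.ilt e (.var 2)) (.and (.ilt f (.var 2)) (.not (angleTest 6 7 e f))))

/-- Test whether the cut before position `k` (integer variable `4`) can be matched by a direction
for the second set; `r` tells whether the latter is upper. -/
def matchTest (r : ℕ) : BExp :=
  .and (.and
    (belowTest (.get (10 + r) (.var 4)) (.get (12 + (1 - r)) (.var 4)))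
    (belowTest (.get (10 + r) (.var 4)) (.get (16 + r) (.sub (.var 2) (.var 4)))))
    (.and
    (belowTest (.get (14 + (1 - r)) (.sub (.var 2) (.var 4))) (.get (12 + (1 - r)) (.var 4)))
    (belowTest (.get (14 + (1 - r)) (.sub (.var 2) (.var 4)))
      (.get (16 + r) (.sub (.var 2) (.var 4)))))

/-- Test whether some direction for the first set is between the positions `k - 1` and `k`. -/
def gapTest : BExp :=
  .not (.and (.ilt (.const 0) (.var 4)) (.and (.ilt (.var 4) (.var 2))
    (.not (angleTest 4 5 (.get 4 (.sub (.var 4) (.const 1))) (.get 4 (.var 4))))))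

/-- Test of a cut. -/
def cutTest : BExp := .and gapTest (.not (.and (.not (matchTest 0)) (.not (matchTest 1))))

/-- One step of the search for a cut. -/
def findBody : Prog :=
  .ite cutTest (.setI 1 (.const 1) ;; .setI 3 (.var 4)) .skip ;; .setI 4 (.add (.var 4) (.const 1))

/-- Search for a cut. -/
def findProg : Prog :=
  .setI 4 (.const 0) ;; .loop (.not (.ilt (.var 2) (.var 4))) findBody

section
variable {α : Type*} [LinearOrder α] {κ : ℕ → α} {N W : ℕ}

theorem belowTest_holds {s : State} (hN : s.iv 2 = N) (hκ : IsKey 6 7 κ N s) {e f : IExp}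
    {S S' : ℕ → Prop} (h : IsBest (OrderDual.toDual ∘ κ) N S (e.eval s))
    (h' : IsBest κ N S' (f.eval s)) :
    (belowTest e f).holds s ↔ ∀ x y, S x → S' y → κ x < κ y := by
  rw [h.forall_lt_iff h']
  simp only [belowTest, BExp.holds, angleTest, RExp.eval, Int.cast_zero, IExp.eval, hN]
  constructor
  · intro hn he hf
    rw [← hκ _ he _ hf]
    by_contra hlt
    exact hn ⟨he, hf, hlt⟩
  · rintro hlt ⟨he, hf, hn⟩
    exact hn ((hκ _ he _ hf).2 (hlt he hf))

/-- The lower side must contain the positions before `k` of type `r` and those from `k` on of type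
`1 - r`; the upper side has the other two classes. Two maxima against two minima make four
comparisons. -/
theorem matchTest_holds {s : State} (hN : s.iv 2 = N) (hκ : IsKey 6 7 κ N s)
    (hs : ScanResult κ N s) (ht : ∀ j < N, s.ia 3 (s.ia 4 j) < 2) {r : ℕ} (hr : r < 2)
    {k : ℕ} (hk : k ≤ N) (h4 : s.iv 4 = k) :
    (matchTest r).holds s ↔
      Separates N (κ ∘ s.ia 4) (fun j => k ≤ j ↔ s.ia 3 (s.ia 4 j) = r) := by
  have h1 := hs.preMax r hr k hk
  have h2 := hs.preMin (1 - r) (by omega) k hk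
  have h3 := hs.sufMax (1 - r) (by omega) k hk
  have h4' := hs.sufMin r hr k hk
  have hw : (IExp.var 4).eval s = k := h4
  have hw' : (IExp.sub (.var 2) (.var 4)).eval s = N - k := by simp [h4, hN]
  rw [← hw] at h1 h2
  rw [← hw'] at h3 h4'
  simp only [matchTest, BExp.holds]
  rw [belowTest_holds hN hκ (e := .get (10 + r) (.var 4)) (f := .get (12 + (1 - r)) (.var 4)) h1 h2,
    belowTest_holds hN hκ (e := .get (10 + r) (.var 4))
      (f := .get (16 + r) (.sub (.var 2) (.var 4))) h1 h4',
    belowTest_holds hN hκ (e := .get (14 + (1 - r)) (.sub (.var 2) (.var 4)))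
      (f := .get (12 + (1 - r)) (.var 4)) h3 h2,
    belowTest_holds hN hκ (e := .get (14 + (1 - r)) (.sub (.var 2) (.var 4)))
      (f := .get (16 + r) (.sub (.var 2) (.var 4))) h3 h4']
  rw [hw]
  constructor
  · rintro ⟨⟨hA, hB⟩, hC, hD⟩ e he f hf hne hTf
    have hte := ht e he
    have htf := ht f hf
    simp only [Function.comp]
    by_cases hke : k ≤ e <;> by_cases hkf : k ≤ f <;> simp only [hke, hkf, true_iff, false_iff,
      not_not] at hne hTf
    · exact hD _ _ ⟨e, he, hke, rfl, by omega⟩ ⟨f, hf, hkf, rfl, hTf⟩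
    · exact hC _ _ ⟨e, he, hke, rfl, by omega⟩ ⟨f, by omega, rfl, by omega⟩
    · exact hB _ _ ⟨e, by omega, rfl, hne⟩ ⟨f, hf, hkf, rfl, hTf⟩
    · exact hA _ _ ⟨e, by omega, rfl, hne⟩ ⟨f, by omega, rfl, by omega⟩
  · intro h
    refine ⟨⟨?_, ?_⟩, ?_, ?_⟩
    · rintro _ _ ⟨e, he, rfl, hte⟩ ⟨f, hf, rfl, htf⟩
      exact h e (by omega) f (by omega) (by omega) (by omega)
    · rintro _ _ ⟨e, he, rfl, hte⟩ ⟨f, hf, hkf, rfl, htf⟩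
      exact h e (by omega) f (by omega) (by omega) (by omega)
    · rintro _ _ ⟨e, he, hke, rfl, hte⟩ ⟨f, hf, rfl, htf⟩
      exact h e (by omega) f (by omega) (by omega) (by omega)
    · rintro _ _ ⟨e, he, hke, rfl, hte⟩ ⟨f, hf, hkf, rfl, htf⟩
      exact h e (by omega) f (by omega) (by omega) (by omega)

theorem gapTest_holds {s : State} (hN : s.iv 2 = N) (hκ : IsKey 4 5 κ N s)
    (hord : ∀ j < N, s.ia 4 j < N)
    (hsort : ∀ i j, i ≤ j → j < N → κ (s.ia 4 i) ≤ κ (s.ia 4 j)) {k : ℕ} (h4 : s.iv 4 = k) :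
    gapTest.holds s ↔ Separates N (κ ∘ s.ia 4) (fun j => k ≤ j) := by
  rw [separates_iff_of_monotone (κ := κ ∘ s.ia 4) hsort]
  simp only [gapTest, BExp.holds, angleTest, RExp.eval, Int.cast_zero, IExp.eval, hN, h4,
    Function.comp]
  constructor
  · intro hn h0 hk
    rw [← hκ _ (hord _ (by omega)) _ (hord _ hk)]
    by_contra hlt
    exact hn ⟨h0, hk, hlt⟩
  · rintro hlt ⟨h0, hk, hn⟩
    exact hn ((hκ _ (hord _ (by omega)) _ (hord _ hk)).2 (hlt h0 hk))
end

/-- There are `N + 1` cuts to try, with the two trivial ones. The reversal `r` is not recorded,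
since the cut alone determines the ordering. -/
theorem findProg_runs {N W : ℕ} (hW : 8 * (N + 1) ≤ W) {s₀ : State} (hN : s₀.iv 2 = N)
    (h1 : s₀.iv 1 = 0) (h3 : s₀.iv 3 = 0) {Good : ℕ → Prop}
    (hgood : ∀ s : State, ∀ k ≤ N, s.iv 2 = N → s.iv 4 = k → s.ra = s₀.ra → s.ia = s₀.ia →
      (cutTest.holds s ↔ Good k)) :
    Runs W findProg s₀ ((findBody.bound + 20) * (N + 2)) fun s =>
      s.iv 0 = s₀.iv 0 ∧ s.iv 2 = N ∧ s.ra = s₀.ra ∧ s.ia = s₀.ia ∧ s.iv 3 ≤ N ∧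
        ((s.iv 1 = 0 ∧ ∀ k ≤ N, ¬ Good k) ∨ (s.iv 1 = 1 ∧ Good (s.iv 3))) := by
  refine Runs.mono (Runs.seq (R := fun s => s.iv 4 = 0 ∧
      s.iv 0 = s₀.iv 0 ∧ s.iv 2 = N ∧ s.ra = s₀.ra ∧ s.ia = s₀.ia ∧ s.iv 3 ≤ N ∧
        ((s.iv 1 = 0 ∧ ∀ k < 0, ¬ Good k) ∨ (s.iv 1 = 1 ∧ Good (s.iv 3)))) (Runs.of_wp ?_)
    fun s₁ hs₁ => Runs.loop (T := findBody.bound) (fun m s => s.iv 4 = m ∧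
      s.iv 0 = s₀.iv 0 ∧ s.iv 2 = N ∧ s.ra = s₀.ra ∧ s.ia = s₀.ia ∧ s.iv 3 ≤ N ∧
        ((s.iv 1 = 0 ∧ ∀ k < m, ¬ Good k) ∨ (s.iv 1 = 1 ∧ Good (s.iv 3)))) (N + 1) ?_ ?_ hs₁) ?_ ?_
  · simp only [wp, IExp.eval]
    refine ⟨by omega, by simp, by simp, by simp [hN], rfl, rfl, by simp [h3], .inl ⟨by simp [h1], ?_⟩⟩
    simp
  · rintro m s hm ⟨h4, h0, h2, hra, hia, hs3, hor⟩
    refine ⟨by simp [h4, h2]; omega, Runs.of_wp ?_⟩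
    have hg := hgood s m (by omega) h2 h4 hra hia
    simp only [findBody, wp, IExp.eval, State.setI_iv, hg, h4]
    norm_num only [if_true, if_false]
    refine ⟨fun hb => ⟨by omega, by omega, by omega, by simp, by simp [h0], by simp [h2], hra, hia,
      by omega, .inr ⟨by simp, by simpa using hb⟩⟩, fun hb =>
      ⟨by omega, by simp, by simp [h0], by simp [h2], hra, hia, by simpa using hs3, ?_⟩⟩
    rcases hor with ⟨h1, hor⟩ | hor
    · refine .inl ⟨by simpa using h1, fun k hk => ?_⟩
      rcases Nat.lt_succ_iff_lt_or_eq.1 hk with hk | rfl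
      · exact hor k hk
      · exact hb
    · exact .inr (by simpa using hor)
  · rintro s ⟨h4, -, h2, -⟩
    simp [h4, h2]
  · simp only [Prog.bound, IExp.cost, BExp.cost]
    nlinarith
  · rintro s ⟨-, h0, h2, hra, hia, hs3, hor⟩
    exact ⟨h0, h2, hra, hia, hs3, hor.imp_left fun h => ⟨h.1, fun k hk => h.2 k (by omega)⟩⟩

/-! ### From the cut to the list of labels -/

/-- Note the order of the two labels in the pair at position `j` (integer variable `4`). -/
def matBody : Prog :=
  .setI 5 (.get 4 (.var 4)) ;;
  .ite (.ilt (.var 4) (.var 3))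
    (.putI 6 (.add (.mul (.get 2 (.var 5)) (.var 0)) (.get 1 (.var 5))) (.const 1))
    (.putI 6 (.add (.mul (.get 1 (.var 5)) (.var 0)) (.get 2 (.var 5))) (.const 1)) ;;
  .setI 4 (.add (.var 4) (.const 1))

/-- Compute the matrix of the order of the labels. -/
def matProg : Prog := .setI 4 (.const 0) ;; .loop (.ilt (.var 4) (.var 2)) matBody

open Classical in
theorem update_matrix {n : ℕ} {M : ℕ → ℕ} {R R' : ℕ → ℕ → Prop} {d d' : ℕ} (hd' : d' < n)
    (h : ∀ c < n, ∀ c' < n, M (c * n + c') = if R c c' then 1 else 0)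
    (hR : ∀ c c', R' c c' ↔ R c c' ∨ (c = d ∧ c' = d')) :
    ∀ c < n, ∀ c' < n,
      Function.update M (d * n + d') 1 (c * n + c') = if R' c c' then 1 else 0 := by
  intro c hc c' hc'
  by_cases heq : c * n + c' = d * n + d'
  · obtain ⟨rfl, rfl⟩ := eq_and_eq_of_mul_add_eq hd' hc' heq
    simp [hR]
  · rw [Function.update_of_ne heq, h c hc c' hc']
    have : ¬ (c = d ∧ c' = d') := by rintro ⟨rfl, rfl⟩; exact heq rfl
    simp [hR, this]

theorem Precedes.succ_iff {N : ℕ} {a b : ℕ → ℕ} {T : ℕ → Prop} {c c' : ℕ} :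
    Precedes (N + 1) a b T c c' ↔ Precedes N a b T c c' ∨
      ((T N ∧ a N = c ∧ b N = c') ∨ (¬ T N ∧ b N = c ∧ a N = c')) := by
  constructor
  · rintro ⟨e, he, h⟩
    rcases Nat.lt_succ_iff_lt_or_eq.1 he with he | rfl
    · exact .inl ⟨e, he, h⟩
    · exact .inr h
  · rintro (⟨e, he, h⟩ | h)
    · exact ⟨e, by omega, h⟩
    · exact ⟨N, by omega, h⟩

open Classical in
theorem matProg_runs {n N W : ℕ} (hW : 8 * (N + 1) ≤ W) (hW' : 8 * (n + 2) ^ 2 ≤ W) {s₀ : State}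
    (h0 : s₀.iv 0 = n) (hN : s₀.iv 2 = N) (h6 : ∀ x, s₀.ia 6 x = 0)
    (hord : ∀ j < N, s₀.ia 4 j < N)
    (ha : ∀ j < N, s₀.ia 1 (s₀.ia 4 j) < n) (hb : ∀ j < N, s₀.ia 2 (s₀.ia 4 j) < n) :
    Runs W matProg s₀ ((matBody.bound + 20) * (N + 1)) fun s => Agree {6} s₀ s ∧
      ∀ c < n, ∀ c' < n, s.ia 6 (c * n + c') =
        if Precedes N (s₀.ia 1 ∘ s₀.ia 4) (s₀.ia 2 ∘ s₀.ia 4) (fun j => s₀.iv 3 ≤ j) c c'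
        then 1 else 0 := by
  refine Runs.mono (Runs.seq (R := fun s => s.iv 4 = 0 ∧ Agree {6} s₀ s ∧
      ∀ c < n, ∀ c' < n, s.ia 6 (c * n + c') =
        if Precedes 0 (s₀.ia 1 ∘ s₀.ia 4) (s₀.ia 2 ∘ s₀.ia 4) (fun j => s₀.iv 3 ≤ j) c c'
        then 1 else 0) (Runs.of_wp ?_)
    fun s₁ hs₁ => Runs.loop (T := matBody.bound) (fun j s => s.iv 4 = j ∧ Agree {6} s₀ s ∧
      ∀ c < n, ∀ c' < n, s.ia 6 (c * n + c') =
        if Precedes j (s₀.ia 1 ∘ s₀.ia 4) (s₀.ia 2 ∘ s₀.ia 4) (fun j => s₀.iv 3 ≤ j) c c'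
        then 1 else 0) N ?_ ?_ hs₁) ?_ fun s hs => hs.2
  · simp only [wp, IExp.eval]
    refine ⟨by omega, by simp, (Agree.refl _ _).setI (by norm_num) _, fun c _ c' _ => ?_⟩
    rw [if_neg (by rintro ⟨e, he, -⟩; omega)]
    exact h6 _
  · rintro j s hj ⟨h4, hag, hM⟩
    have hs0 : s.iv 0 = n := (hag.1 0 (by norm_num)).trans h0
    have hs2 : s.iv 2 = N := (hag.1 2 (by norm_num)).trans hN
    have hs3 : s.iv 3 = s₀.iv 3 := hag.1 3 (by norm_num)
    have hi1 : s.ia 1 = s₀.ia 1 := hag.2.2 1 (by simp)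
    have hi2 : s.ia 2 = s₀.ia 2 := hag.2.2 2 (by simp)
    have hi4 : s.ia 4 = s₀.ia 4 := hag.2.2 4 (by simp)
    have haj := ha j hj
    have hbj := hb j hj
    have hoj := hord j hj
    have hmn : ∀ d < n, ∀ d' < n, d * n + d' < W := fun d hd d' hd' => by
      nlinarith [Nat.mul_le_mul_right n (Nat.succ_le_of_lt hd)]
    refine ⟨by simp [h4, hs2, hj], Runs.of_wp ?_⟩
    simp only [matBody, wp, IExp.eval, BExp.holds, State.setI_iv, State.setI_ia, State.putI_iv,
      h4, hs0, hs3, hi1, hi2, hi4]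
    norm_num only [if_true, if_false]
    refine ⟨by omega, fun hlt => ⟨hmn _ hbj _ haj, by omega, by omega, by simp,
      ((hag.setI (by norm_num) _).putI (by simp) _ _).setI (by norm_num) _, ?_⟩,
      fun hlt => ⟨hmn _ haj _ hbj, by omega, by omega, by simp,
      ((hag.setI (by norm_num) _).putI (by simp) _ _).setI (by norm_num) _, ?_⟩⟩
    · simp only [State.setI_ia, State.putI_ia, if_true]
      refine update_matrix haj hM fun c c' => ?_
      rw [Precedes.succ_iff]
      simp only [not_le.2 hlt, Function.comp, false_and, false_or, not_false_iff, true_and,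
        eq_comm]
    · simp only [State.setI_ia, State.putI_ia, if_true]
      refine update_matrix hbj hM fun c c' => ?_
      rw [Precedes.succ_iff]
      simp only [not_lt.1 hlt, Function.comp, false_and, or_false, not_true, true_and,
        eq_comm]
  · rintro s ⟨h4, hag, -⟩
    simp [h4, hag.1, hN]
  · simp only [Prog.bound, IExp.cost, BExp.cost]
    nlinarith

/-- Add up the column of the matrix for the label in the integer variable `4`. -/
def sumBody : Prog :=
  .setI 6 (.add (.var 6) (.get 6 (.add (.mul (.var 5) (.var 0)) (.var 4)))) ;;
  .setI 5 (.add (.var 5) (.const 1))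

/-- Write the labels to the array `0`, in their order. -/
def rankProg : Prog :=
  .setI 4 (.const 0) ;;
  .loop (.ilt (.var 4) (.var 0))
    ((.setI 5 (.const 0) ;; .setI 6 (.const 0)) ;;
      .loop (.ilt (.var 5) (.var 0)) sumBody ;;
      (.putI 0 (.var 6) (.var 4) ;; .setI 4 (.add (.var 4) (.const 1))))

/-- A column sum counts the labels that precede a given one. Distinctness of the sums is only a
premise of the conclusion, because the program also runs when no cut was found; `hM` keeps the
addresses in range in any case. -/
theorem rankProg_runs {n W : ℕ} (hW : 8 * (n + 2) ^ 2 ≤ W) {s₀ : State} (h0 : s₀.iv 0 = n)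
    (hM : ∀ c < n, ∀ c' < n, s₀.ia 6 (c * n + c') ≤ 1) :
    Runs W rankProg s₀ ((sumBody.bound + 30) * (n + 1) ^ 2) fun s => s.iv 1 = s₀.iv 1 ∧
      ((∀ c < n, ∀ c' < n, ∑ d ∈ Finset.range n, s₀.ia 6 (d * n + c) =
          ∑ d ∈ Finset.range n, s₀.ia 6 (d * n + c') → c = c') →
        ∀ c < n, s.ia 0 (∑ d ∈ Finset.range n, s₀.ia 6 (d * n + c)) = c) := by
  have hW1 : n * n + n + 2 < W := by nlinarith
  set rk : ℕ → ℕ := fun c => ∑ d ∈ Finset.range n, s₀.ia 6 (d * n + c) with hrk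
  have hle : ∀ c < n, ∀ m ≤ n, ∑ d ∈ Finset.range m, s₀.ia 6 (d * n + c) ≤ m := by
    intro c hc m hm
    calc ∑ d ∈ Finset.range m, s₀.ia 6 (d * n + c) ≤ ∑ d ∈ Finset.range m, 1 :=
          Finset.sum_le_sum fun d hd => hM d (by have := Finset.mem_range.1 hd; omega) c hc
      _ = m := by simp
  refine Runs.mono (Runs.seq (R := fun s => s.iv 4 = 0 ∧ Agree {0} s₀ s ∧
      ((∀ c < n, ∀ c' < n, rk c = rk c' → c = c') → ∀ c < 0, s.ia 0 (rk c) = c)) (Runs.of_wp ?_)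
    fun s₁ hs₁ => Runs.loop (T := (sumBody.bound + 4) * n + 20) (fun m s => s.iv 4 = m ∧
      Agree {0} s₀ s ∧
      ((∀ c < n, ∀ c' < n, rk c = rk c' → c = c') → ∀ c < m, s.ia 0 (rk c) = c)) n ?_ ?_ hs₁)
    ?_ fun s hs => ⟨hs.2.1.1 1 (by norm_num), hs.2.2⟩
  · simp only [wp, IExp.eval]
    exact ⟨by omega, by simp, (Agree.refl _ _).setI (by norm_num) _, by simp⟩
  · rintro c s hc ⟨h4, hag, hout⟩
    have hs0 : s.iv 0 = n := (hag.1 0 (by norm_num)).trans h0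
    refine ⟨by simp [h4, hs0, hc], ?_⟩
    refine Runs.mono (Runs.seq (R := fun s' => s'.iv 4 = c ∧ Agree {0} s₀ s' ∧
        s'.ia = s.ia ∧ s'.iv 5 = 0 ∧
        s'.iv 6 = ∑ d ∈ Finset.range 0, s₀.ia 6 (d * n + c)) (Runs.of_wp ?_) fun s₁ hs₁ =>
      Runs.seq (Runs.loop (T := sumBody.bound) (fun m s' => s'.iv 4 = c ∧ Agree {0} s₀ s' ∧
        s'.ia = s.ia ∧ s'.iv 5 = m ∧
        s'.iv 6 = ∑ d ∈ Finset.range m, s₀.ia 6 (d * n + c)) n ?_ ?_ hs₁) fun s₂ hs₂ =>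
      Runs.of_wp ?_) ?_ (fun _ => id)
    · simp only [wp, IExp.eval]
      exact ⟨by omega, by omega, by simp [h4],
        (hag.setI (by norm_num) _).setI (by norm_num) _, rfl, by simp, by simp⟩
    · rintro m s' hm ⟨h4, hag, hia, h5, h6⟩
      have hs0 : s'.iv 0 = n := (hag.1 0 (by norm_num)).trans h0
      have hi6 : s'.ia 6 = s₀.ia 6 := hag.2.2 6 (by simp)
      refine ⟨by simp [h5, hs0, hm], Runs.of_wp ?_⟩
      have h1 := hle c hc m hm.le
      have h2 := hM m hm c hc
      simp only [wp, sumBody, IExp.eval, State.setI_iv, h4, h5, h6, hs0, hi6]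
      norm_num only [if_true, if_false]
      refine ⟨by omega, by omega, by simp, (hag.setI (by norm_num) _).setI (by norm_num) _,
        hia, by simp, ?_⟩
      rw [Finset.sum_range_succ]
    · rintro s' ⟨h4, hag, hia, h5, h6⟩
      simp [h5, hag.1, h0]
    · obtain ⟨h4, hag, hia, h5, h6⟩ := hs₂
      have h1 := hle c hc n le_rfl
      simp only [wp, IExp.eval, State.putI_iv, h4, h6]
      refine ⟨by omega, by omega, by omega, by simp, (hag.putI (by simp) _ _).setI (by norm_num) _,
        fun hinj c' hc' => ?_⟩
      simp only [State.setI_ia, State.putI_ia, if_true, hia]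
      rcases Nat.lt_succ_iff_lt_or_eq.1 hc' with hc' | rfl
      · rw [Function.update_of_ne fun h => hc'.ne (hinj c' (by omega) c hc h)]
        exact hout hinj c' hc'
      · simp [hrk]
    · simp only [Prog.bound, IExp.cost, BExp.cost]
      nlinarith
  · rintro s ⟨h4, hag, -⟩
    simp [h4, hag.1, h0]
  · simp only [Prog.bound, IExp.cost, BExp.cost]
    nlinarith
end RealRAM
-- Correctness and running time of the whole algorithm
namespace RealRAM

/-- The algorithm. -/
def mainProg : Prog :=
  pairProg ;; sortProg ;; scansProg ;; findProg ;; matProg ;; rankProg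

/-- A constant for the running time of `mainProg`. -/
def mainConst : ℕ :=
  (pairBody.bound + 20) + (mergeBody.bound + copyBody.bound + 70) +
    8 * ((scanBody 10 bwd 0 maxTest).bound + 20) + 2 * (findBody.bound + 20) +
    (matBody.bound + 20) + (sumBody.bound + 30)

/-- Only the sort, with cost `t₂`, brings in the logarithmic factor `L + 1`; all other costs are
linear in `N` or quadratic in `n`. -/
theorem sum_costs_le {n N L c₁ c₂ c₃ c₄ c₅ c₆ t₁ t₂ t₃ t₄ t₅ t₆ : ℕ} (hN : N ≤ n * n)
    (h₁ : t₁ ≤ c₁ * (n + 1) ^ 2) (h₂ : t₂ ≤ c₂ * (N + 1) * (L + 1)) (h₃ : t₃ ≤ 8 * (c₃ * (N + 1)))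
    (h₄ : t₄ ≤ c₄ * (N + 2)) (h₅ : t₅ ≤ c₅ * (N + 1)) (h₆ : t₆ ≤ c₆ * (n + 1) ^ 2) :
    t₁ + (t₂ + (t₃ + (t₄ + (t₅ + t₆)))) ≤
      (c₁ + c₂ + 8 * c₃ + 2 * c₄ + c₅ + c₆) * ((n + 1) ^ 2 * (L + 1)) := by
  have e1 : N + 1 ≤ (n + 1) ^ 2 := by nlinarith
  have e2 : N + 2 ≤ 2 * (n + 1) ^ 2 := by nlinarith
  have e3 : (n + 1) ^ 2 ≤ (n + 1) ^ 2 * (L + 1) := Nat.le_mul_of_pos_right _ (by omega)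
  have e4 := Nat.mul_le_mul_right (L + 1) e1
  have e5 := e1.trans e3
  have b₁ := h₁.trans (Nat.mul_le_mul_left _ e3)
  have b₂ := h₂.trans (le_of_eq (mul_assoc ..)) |>.trans (Nat.mul_le_mul_left _ e4)
  have b₃ := h₃.trans (Nat.mul_le_mul_left 8 (Nat.mul_le_mul_left _ e5))
  have b₄ := h₄.trans (Nat.mul_le_mul_left _ (e2.trans (Nat.mul_le_mul_left 2 e3)))
  have b₅ := h₅.trans (Nat.mul_le_mul_left _ e5)
  have b₆ := h₆.trans (Nat.mul_le_mul_left _ e3)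
  linarith

theorem isKey_angleKey {N : ℕ} {s : State} {x y : ℕ}
    (h : ∀ e < N, IsUpper (s.ra x e) (s.ra y e)) :
    IsKey x y (fun e => angleKey (s.ra x e) (s.ra y e)) N s :=
  fun e he f hf => cross_pos_iff_angleKey_lt (h e he) (h f hf)

theorem mainProg_runs {n : ℕ} {P Q : Fin n → Plane} (hP : Function.Injective P)
    (hQ : Function.Injective Q) :
    ∃ N ≤ n * n, Runs ((n + 2) ^ 5) mainProg (inputState P Q)
      (mainConst * ((n + 1) ^ 2 * (Nat.clog 2 N + 1))) (IsCorrectOutput P Q) := by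
  classical
  -- The exponent 5 is 2 + 3: the factor `(n + 2) ^ 3` absorbs the constant 8.
  have hW : 8 * (n + 2) ^ 2 ≤ (n + 2) ^ 5 := by
    have : 2 ^ 3 ≤ (n + 2) ^ 3 := Nat.pow_le_pow_left (by omega) 3
    calc 8 * (n + 2) ^ 2 ≤ (n + 2) ^ 3 * (n + 2) ^ 2 := Nat.mul_le_mul_right _ this
      _ = (n + 2) ^ 5 := by ring
  have hq : ∀ c < n, ∀ c' < n, c ≠ c' →
      ¬ (coordArray Q 0 c' - coordArray Q 0 c = 0 ∧ coordArray Q 1 c' - coordArray Q 1 c = 0) := by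
    intro c hc c' hc' hne
    have := plane_sub_ne hQ (c := ⟨c, hc⟩) (c' := ⟨c', hc'⟩) (by simpa using hne)
    simpa [← coordArray_val] using this
  have hinit : PairInv n (coordArray P 0) (coordArray P 1) (coordArray Q 0) (coordArray Q 1) 0
      (inputState P Q) := by
    constructor <;> try simp [inputState]
    exact IsPairTable.zero
  obtain ⟨s₁, t₁, he₁, ht₁, h₁⟩ := pairProg_runs hW hq hinit (by simp [inputState])
  set N := s₁.iv 2 with hN
  have hNn : N ≤ n * n := h₁.card_le
  have hW' : 8 * (N + 1) ≤ (n + 2) ^ 5 := by nlinarith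
  have htab := h₁.table
  set κP : ℕ → WithBot ℝ := fun e => angleKey (s₁.ra 4 e) (s₁.ra 5 e) with hκP
  set κQ : ℕ → WithBot ℝ := fun e => angleKey (s₁.ra 6 e) (s₁.ra 7 e) with hκQ
  have hkP : IsKey 4 5 κP N s₁ := isKey_angleKey htab.upper
  have hkQ : IsKey 6 7 κQ N s₁ := isKey_angleKey htab.upper'
  obtain ⟨s₂, t₂, he₂, ht₂, hag₂, hsort, hlt, hsurj⟩ := sortProg_runs hW' hN.symm hkP h₁.ord
  set o := s₂.ia 4 with ho
  have hN₂ : s₂.iv 2 = N := hag₂.1 2 (by norm_num)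
  obtain ⟨s₃, t₃, he₃, ht₃, hag₃, hscan⟩ := scansProg_runs hW' hN₂ (hkQ.congr hag₂.2.1) hlt
  have hra₃ : s₃.ra = s₁.ra := hag₃.2.1.trans hag₂.2.1
  have hiv₃ : ∀ x < 4, s₃.iv x = s₁.iv x := fun x hx => (hag₃.1 x hx).trans (hag₂.1 x hx)
  have hia₃ : ∀ a ∉ ({4, 5} : Set ℕ), a < 10 → s₃.ia a = s₁.ia a := fun a ha ha' =>
    (hag₃.2.2 a (by simp; omega)).trans (hag₂.2.2 a ha)
  have hia1 : s₃.ia 1 = s₁.ia 1 := hia₃ 1 (by simp) (by norm_num)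
  have hia2 : s₃.ia 2 = s₁.ia 2 := hia₃ 2 (by simp) (by norm_num)
  have hia3 : s₃.ia 3 = s₁.ia 3 := hia₃ 3 (by simp) (by norm_num)
  have hia6 : s₃.ia 6 = s₁.ia 6 := hia₃ 6 (by simp) (by norm_num)
  have hia4 : s₃.ia 4 = o := hag₃.2.2 4 (by simp)
  have htab' := htab.comp hlt hsurj
  have hN₃ : s₃.iv 2 = N := hiv₃ 2 (by norm_num)
  have htype : ∀ j < N, s₃.ia 3 (s₃.ia 4 j) < 2 := by
    intro j hj
    rw [hia3, hia4]
    rcases htab'.type j hj with h | h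
    · exact lt_of_eq_of_lt h.1 (by norm_num)
    · exact lt_of_eq_of_lt h.1 (by norm_num)
  -- Position `k` is at a strict gap of the first family, and the orientations it induces are
  -- realized in the second set up to reversal.
  let Good : ℕ → Prop := fun k => Separates N (κP ∘ o) (fun j => k ≤ j) ∧
    ∃ r < 2, Separates N (κQ ∘ o) (fun j => k ≤ j ↔ s₁.ia 3 (o j) = r)
  obtain ⟨s₄, t₄, he₄, ht₄, hs0, hs2, hra, hia, hs3, hor⟩ := findProg_runs (Good := Good) hW' hN₃
    ((hiv₃ 1 (by norm_num)).trans h₁.found) ((hiv₃ 3 (by norm_num)).trans h₁.cut) (by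
      intro s k hk h2 h4 hsra hsia
      have hra' : s.ra = s₁.ra := hsra.trans hra₃
      have hscan' : ScanResult κQ N s := by
        obtain ⟨e1, e2, e3, e4⟩ := hscan
        constructor <;> simpa only [hsia]
      have g := gapTest_holds h2 (hkP.congr hra') (by simpa [hsia, hia4] using hlt)
        (by simpa [hsia, hia4] using hsort) h4
      have m := fun r (hr : r < 2) => matchTest_holds h2 (hkQ.congr hra') hscan'
        (by simpa only [hsia] using htype) hr hk h4
      simp only [hsia, hia4, hia3] at g m
      simp only [cutTest, BExp.holds, g, m 0 (by norm_num), m 1 (by norm_num), Good]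
      refine and_congr_right fun _ => ?_
      constructor
      · intro h
        by_contra hn
        push Not at hn
        exact h ⟨hn 0 (by norm_num), hn 1 (by norm_num)⟩
      · rintro ⟨r, hr, h⟩ ⟨h0, h1⟩
        interval_cases r
        · exact h0 h
        · exact h1 h)
  have hs0' : s₄.iv 0 = n := by rw [hs0, hiv₃ 0 (by norm_num), h₁.n_eq]
  obtain ⟨s₅, t₅, he₅, ht₅, hag₅, hmat⟩ := matProg_runs hW' hW hs0' hs2
    (by rw [hia, hia6]; exact h₁.mat) (by rw [hia, hia4]; exact hlt)
    (by rw [hia, hia4, hia1]; exact htab'.a_lt) (by rw [hia, hia4, hia2]; exact htab'.b_lt)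
  rw [hia, hia4, hia1, hia2] at hmat
  obtain ⟨s₆, t₆, he₆, ht₆, hs1, hout⟩ := rankProg_runs hW ((hag₅.1 0 (by norm_num)).trans hs0')
    (by
      intro c hc c' hc'
      rw [hmat c hc c' hc']
      split_ifs <;> norm_num)
  have hs1' : s₆.iv 1 = s₄.iv 1 := hs1.trans (hag₅.1 1 (by norm_num))
  refine ⟨N, hNn, s₆, _, he₁.seq (he₂.seq (he₃.seq (he₄.seq (he₅.seq he₆)))), ?_, ?_⟩
  · exact sum_costs_le hNn ht₁ ht₂ ht₃ ht₄ ht₅ ht₆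
  · rcases hor with ⟨h1, hno⟩ | ⟨h1, hsep, r, hr, hsep'⟩
    · refine .inr ⟨hs1'.trans h1, ?_⟩
      rintro ⟨σ, hσ⟩
      -- A compatible ordering would yield a cut that the search accepts.
      obtain ⟨T, r, hr, hT, hT'⟩ := htab'.exists_separates hσ
      obtain ⟨k, hk, hTk⟩ := Separates.exists_cut (κ := κP ∘ o) hsort hT
      exact hno k hk ⟨hT.congr hTk, r, hr, hT'.congr fun j hj => by rw [hTk j hj]; rfl⟩
    · obtain ⟨f, σ, hσ, hrank, hinj, hprec⟩ := htab'.exists_compatible hP hr hsep hsep'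
      have hsum : ∀ c : Fin n, ∑ d ∈ Finset.range n, s₅.ia 6 (d * n + c) = labelRank f c := by
        intro c
        rw [Finset.sum_range, labelRank, Finset.card_filter]
        refine Finset.sum_congr rfl fun d _ => ?_
        rw [hmat d d.2 c c.2]
        exact if_congr (hprec d c).symm rfl rfl
      have hout' := hout fun c hc c' hc' heq => by
        rw [hsum ⟨c, hc⟩, hsum ⟨c', hc'⟩] at heq
        exact Fin.mk.inj (hinj heq)
      refine .inl ⟨hs1'.trans h1, σ, hσ, fun i => ?_⟩
      have := hout' (σ i) (σ i).2
      rwa [hsum, ← hrank, σ.symm_apply_apply] at this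

end RealRAM

/-- The bound of `RealRAM.mainProg_runs` is of the order `n ^ 2 * log n`. -/
theorem clog_add_one_le {n N : ℕ} (hn : 2 ≤ n) (hN : N ≤ n * n) :
    ((Nat.clog 2 N + 1 : ℕ) : ℝ) ≤ 5 / Real.log 2 * Real.log n := by
  -- From `N ≤ n ^ 2`, the left side of the claim is at most 2 log₂ n + 3, hence at most 5 log₂ n
  -- because log₂ n ≥ 1.
  have h1 : Nat.clog 2 N ≤ 2 * (Nat.log 2 n + 1) := by
    refine Nat.clog_le_of_le_pow (hN.trans ?_)
    have := (Nat.lt_pow_succ_log_self (b := 2) (by norm_num) n).le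
    calc n * n ≤ 2 ^ (Nat.log 2 n + 1) * 2 ^ (Nat.log 2 n + 1) := Nat.mul_le_mul this this
      _ = 2 ^ (2 * (Nat.log 2 n + 1)) := by ring
  have h2 : (Nat.log 2 n : ℝ) ≤ Real.log n / Real.log 2 := by
    have := Real.natLog_le_logb n 2
    simpa [Real.logb] using this
  have h3 : 1 ≤ Real.log n / Real.log 2 := by
    rw [le_div_iff₀ (Real.log_pos (by norm_num)), one_mul]
    exact Real.log_le_log (by norm_num) (by exact_mod_cast hn)
  have h4 : ((Nat.clog 2 N + 1 : ℕ) : ℝ) ≤ 2 * (Nat.log 2 n + 1) + 1 := by exact_mod_cast by omega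
  calc ((Nat.clog 2 N + 1 : ℕ) : ℝ) ≤ 5 * (Real.log n / Real.log 2) := by linarith
    _ = 5 / Real.log 2 * Real.log n := by ring

theorem mainTheorem4 :
    ∃ (p : RealRAM.Prog) (d : ℕ) (C : ℝ),
      ∀ (n : ℕ) (P Q : Fin n → Plane), InGeneralPosition P → InGeneralPosition Q →
        ∃ (s : RealRAM.State) (t : ℕ),
          RealRAM.Exec ((n + 2) ^ d) p (inputState P Q) s t ∧
          IsCorrectOutput P Q s ∧
          (2 ≤ n → (t : ℝ) ≤ C * ((n : ℝ) ^ 2 * Real.log n)) := by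
  -- The factor 4 comes from (n + 1)² ≤ 4n² and the factor `5 / Real.log 2` from `clog_add_one_le`.
  refine ⟨RealRAM.mainProg, 5, RealRAM.mainConst * (4 * (5 / Real.log 2)), ?_⟩
  intro n P Q hP hQ
  obtain ⟨N, hN, s, t, he, ht, hs⟩ := RealRAM.mainProg_runs hP.1 hQ.1
  refine ⟨s, t, he, hs, fun hn => ?_⟩
  have h1 := clog_add_one_le hn hN
  have h2 : ((n : ℝ) + 1) ^ 2 ≤ 4 * (n : ℝ) ^ 2 := by
    have : (2 : ℝ) ≤ n := by exact_mod_cast hn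
    nlinarith
  have h3 : (t : ℝ) ≤ RealRAM.mainConst * (((n : ℝ) + 1) ^ 2 * ((Nat.clog 2 N + 1 : ℕ) : ℝ)) := by
    exact_mod_cast ht
  calc (t : ℝ) ≤ RealRAM.mainConst * (((n : ℝ) + 1) ^ 2 * ((Nat.clog 2 N + 1 : ℕ) : ℝ)) := h3
    _ ≤ RealRAM.mainConst * (4 * (n : ℝ) ^ 2 * (5 / Real.log 2 * Real.log n)) := by gcongr
    _ = RealRAM.mainConst * (4 * (5 / Real.log 2)) * ((n : ℝ) ^ 2 * Real.log n) := by ring
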